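/- For $\operatorname{Re} x>0$ let $\theta_3(x)=\sum_{n\in\mathbb Z}e^{-\pi n^2x}$, and for $|z|<1$ let $\sigma_3(z)=\frac{1}{\sqrt{1+z}}\,\theta_3\!\left(\frac{1-z}{1+z}\right)$ (principal square root). Put $\Phi=\Gamma(1/4)^8/(128\pi^4)$, and let $(d(n))_{n\ge 0}$ be the numbers defined by the Taylor expansion $$\sigma_3(z)=\theta_3(1)\sum_{n=0}^\infty\frac{d(n)}{(2n)!}\,\Phi^n z^{2n}\qquad(|z|<1),$$ that is, $d(n)=\sigma_3^{(2n)}(0)/(\theta_3(1)\Phi^n)$. Near $t=0$ let $$U(t)=\frac{{}_2F_1(\tfrac34,\tfrac34;\tfrac32;4t)}{{}_2F_1(\tfrac14,\tfrac14;\tfrac12;4t)},\qquad V(t)=\sqrt{{}_2F_1(\tfrac14,\tfrac14;\tfrac12;4t)},$$ and, writing $[t^j]f(t)$ for the $j$-th Taylor coefficient of $f$ at $t=0$, define $$v(n)=2^n(2n)!\,[t^n]V(t)\quad(n\ge0),\qquad r(n,k)=2^{n-k}\frac{(2n)!}{(2k)!}\,[t^{n-k}]\,U(t)^{2k}\quad(1\le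 k\le n).$$ Then all the numbers $v(n)$ $(n\ge 0)$ and $r(n,k)$ $(1\le k\le n)$ are integers, and $$d(n)=v(n)-\sum_{k=1}^{n-1}r(n,k)\,d(k)\qquad(n\ge1).$$ -/

import Mathlib

noncomputable section

/-- The Jacobi theta constant `θ₃(x) = ∑_{n ∈ ℤ} exp(-π n² x)`, for `Re x > 0`. -/
def theta3 (x : ℂ) : ℂ :=
  ∑' n : ℤ, Complex.exp (-(Real.pi : ℂ) * (n : ℂ) ^ 2 * x)

/-- The centered theta function `σ₃(z) = (1 + z)^(-1/2) θ₃((1 - z) / (1 + z))`, for `|z| < 1`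
(principal branch of the square root; `1 + z` lies in the right half-plane). -/
def sigma3 (z : ℂ) : ℂ :=
  1 / (1 + z) ^ (1 / 2 : ℂ) * theta3 ((1 - z) / (1 + z))

/-- The constant `Φ = Γ(1/4)⁸ / (128 π⁴)`. -/
def bigPhi : ℝ :=
  Real.Gamma (1 / 4) ^ 8 / (128 * Real.pi ^ 4)

/-- The coefficient `[t^j] f(t)` in the Taylor expansion of `f` around `t = 0`. -/
def taylorCoeff (j : ℕ) (f : ℂ → ℂ) : ℂ :=
  iteratedDeriv j f 0 / (j.factorial : ℂ)

/-- The numbers `d(n)`, read off from the Taylor expansion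
`σ₃(z) = θ₃(1) ∑ₙ d(n) / (2n)! Φⁿ z²ⁿ` around `z = 0`. -/
def dSeq (n : ℕ) : ℂ :=
  ((2 * n).factorial : ℂ) * taylorCoeff (2 * n) sigma3 / (theta3 1 * (bigPhi : ℂ) ^ n)

/-- `U(t) = ₂F₁(3/4, 3/4; 3/2; 4t) / ₂F₁(1/4, 1/4; 1/2; 4t)`. -/
def hypU (t : ℂ) : ℂ :=
  ordinaryHypergeometric (3 / 4 : ℂ) (3 / 4 : ℂ) (3 / 2 : ℂ) (4 * t) /
    ordinaryHypergeometric (1 / 4 : ℂ) (1 / 4 : ℂ) (1 / 2 : ℂ) (4 * t)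

/-- `V(t) = √(₂F₁(1/4, 1/4; 1/2; 4t))` (principal branch; the radicand is `1` at `t = 0`). -/
def hypV (t : ℂ) : ℂ :=
  (ordinaryHypergeometric (1 / 4 : ℂ) (1 / 4 : ℂ) (1 / 2 : ℂ) (4 * t)) ^ (1 / 2 : ℂ)

/-- The numbers `v(n)` with `V(t) = ∑ₙ v(n) / (2ⁿ (2n)!) tⁿ`. -/
def vSeq (n : ℕ) : ℂ :=
  2 ^ n * ((2 * n).factorial : ℂ) * taylorCoeff n hypV

/-- `r(n, k) = 2^(n-k) (2n)! / (2k)! [t^(n-k)] U(t)^(2k)`, used for `1 ≤ k ≤ n` only. -/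
def rArr (n k : ℕ) : ℂ :=
  2 ^ (n - k) * (((2 * n).factorial : ℂ) / ((2 * k).factorial : ℂ)) *
    taylorCoeff (n - k) (fun t => hypU t ^ (2 * k))

end

/-! The heart is the identity σ₃(β s U(s²/4)) = θ₃(1) V(s²/4) near s = 0 (`sigma3_hypergeometric`),
where β² Φ = 1/8.

For x > 0 put s = 2(θ₄/θ₃)⁴ - 1 = 1 - 2λ and K(s) = `centralIntegral s`. The doubling formulas make
(θ₃², θ₄²) at 2x the arithmetic-geometric mean step of the pair at x, so Gauss's invariant integral
equals π/2 (`ellipticIntegral_theta`). A substitution turns this into K(s) = √2 π θ₃(x)². Expanding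
K in s gives an even part c₀ ₂F₁(1/4,1/4;1/2;s²) and an odd part c₁ s ₂F₁(3/4,3/4;3/2;s²). The
inversion x ↦ 1/x sends s to -s and K to xK, so these parts are (1+x)K/2 and (1-x)K/2. Their
quotient is z = (1-x)/(1+x), which equals β s U(s²/4) with β = c₁/c₀; the even part gives σ₃(z)² =
θ₃(1)² V(s²/4)². As x → 1 the parameters s accumulate at 0, and the identity theorem applies.

Since σ₃ is even, comparing coefficients of s²ⁿ gives v(n) = ∑ r(n,k) d(k) over 0 ≤ k ≤ n
(`vSeq_eq_sum`); with r(n,n) = 1 and r(n,0) = 0 for n ≥ 1 this is the recurrence.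

Integrality is separate: it comes from Hurwitz series, which are stable under products, division by
a series with constant term 1, divided powers fᵏ/k! when f(0) = 0, and square roots of 1 + 2h with
value 1 at 0. -/

/-! ### Taylor coefficients at 0 and formal power series. -/

/-- The Taylor series at `0` of a function, as a formal power series. -/
noncomputable def taylorSeries (f : ℂ → ℂ) : PowerSeries ℂ := PowerSeries.mk fun j => taylorCoeff j f

theorem coeff_taylorSeries (f : ℂ → ℂ) (n : ℕ) :
    PowerSeries.coeff n (taylorSeries f) = taylorCoeff n f := by
  simp [taylorSeries]

theorem analyticAt_of_eventually_hasSum {b : ℕ → ℂ} {f : ℂ → ℂ}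
    (h : ∀ᶠ z in nhds (0 : ℂ), HasSum (fun n => b n * z ^ n) (f z)) : AnalyticAt ℂ f 0 := by
  have : HasFPowerSeriesAt f (FormalMultilinearSeries.ofScalars ℂ b) 0 := by
    rw [hasFPowerSeriesAt_iff]
    simpa [FormalMultilinearSeries.coeff_ofScalars, mul_comm] using h
  exact this.analyticAt

theorem taylorCoeff_of_eventually_hasSum {b : ℕ → ℂ} {f : ℂ → ℂ}
    (h : ∀ᶠ z in nhds (0 : ℂ), HasSum (fun n => b n * z ^ n) (f z)) (n : ℕ) :
    taylorCoeff n f = b n := by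
  have h1 : HasFPowerSeriesAt f (FormalMultilinearSeries.ofScalars ℂ b) 0 := by
    rw [hasFPowerSeriesAt_iff]
    simpa [FormalMultilinearSeries.coeff_ofScalars, mul_comm] using h
  have h2 := h1.eq_formalMultilinearSeries h1.analyticAt.hasFPowerSeriesAt
  have h3 := congrArg (fun p => FormalMultilinearSeries.coeff p n) h2
  simp only [FormalMultilinearSeries.coeff_ofScalars] at h3
  exact h3.symm

theorem eventually_hasSum_taylorCoeff {f : ℂ → ℂ} (hf : AnalyticAt ℂ f 0) :
    ∀ᶠ z in nhds (0 : ℂ), HasSum (fun n => taylorCoeff n f * z ^ n) (f z) := by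
  have h := hf.hasFPowerSeriesAt
  rw [hasFPowerSeriesAt_iff] at h
  simpa [FormalMultilinearSeries.coeff_ofScalars, mul_comm, taylorCoeff] using h

theorem taylorCoeff_congr {f g : ℂ → ℂ} (h : f =ᶠ[nhds 0] g) (n : ℕ) :
    taylorCoeff n f = taylorCoeff n g := by
  rw [taylorCoeff, taylorCoeff, h.iteratedDeriv_eq]

theorem taylorSeries_congr {f g : ℂ → ℂ} (h : f =ᶠ[nhds 0] g) :
    taylorSeries f = taylorSeries g := by
  ext n
  simp [coeff_taylorSeries, taylorCoeff_congr h]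

theorem taylorCoeff_zero (f : ℂ → ℂ) : taylorCoeff 0 f = f 0 := by
  simp [taylorCoeff]

theorem taylorSeries_mul {f g : ℂ → ℂ} (hf : AnalyticAt ℂ f 0) (hg : AnalyticAt ℂ g 0) :
    taylorSeries (fun z => f z * g z) = taylorSeries f * taylorSeries g := by
  ext n
  rw [PowerSeries.coeff_mul, Finset.Nat.sum_antidiagonal_eq_sum_range_succ_mk]
  simp only [coeff_taylorSeries, taylorCoeff]
  have := iteratedDeriv_mul (n := n) hf.contDiffAt hg.contDiffAt
  rw [show (fun z => f z * g z) = f * g from rfl, this, Finset.sum_div]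
  refine Finset.sum_congr rfl fun i hi => ?_
  have hi' : i ≤ n := Nat.lt_succ_iff.mp (Finset.mem_range.mp hi)
  rw [Nat.cast_choose ℂ hi']
  have h1 : (n.factorial : ℂ) ≠ 0 := by exact_mod_cast n.factorial_ne_zero
  have h2 : (i.factorial : ℂ) ≠ 0 := by exact_mod_cast i.factorial_ne_zero
  have h3 : ((n - i).factorial : ℂ) ≠ 0 := by exact_mod_cast (n - i).factorial_ne_zero
  field_simp

theorem taylorSeries_const (c : ℂ) : taylorSeries (fun _ => c) = PowerSeries.C c := by
  ext n
  rw [coeff_taylorSeries, PowerSeries.coeff_C, taylorCoeff, iteratedDeriv_const]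
  split_ifs with h
  · subst h; simp
  · simp

theorem taylorSeries_pow {f : ℂ → ℂ} (hf : AnalyticAt ℂ f 0) (k : ℕ) :
    taylorSeries (fun z => f z ^ k) = taylorSeries f ^ k := by
  induction k with
  | zero => simp [taylorSeries_const]
  | succ k ih =>
    simp only [pow_succ]
    rw [taylorSeries_mul (hf.fun_pow k) hf, ih]

theorem taylorSeries_id : taylorSeries (fun z => z) = PowerSeries.X := by
  ext n
  rw [coeff_taylorSeries, PowerSeries.coeff_X]
  refine taylorCoeff_of_eventually_hasSum (b := fun n => if n = 1 then 1 else 0)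
    (Filter.Eventually.of_forall fun z => ?_) n
  convert hasSum_single (f := fun n => (if n = 1 then (1 : ℂ) else 0) * z ^ n) 1
    (by intro b hb; simp [hb]) using 1
  simp

/-- The coefficients of `f (c * s ^ 2)` for `f = ∑ b n t ^ n`. -/
def evenCoeff (c : ℂ) (b : ℕ → ℂ) (n : ℕ) : ℂ := if Even n then c ^ (n / 2) * b (n / 2) else 0

theorem hasSum_evenCoeff {c s y : ℂ} {b : ℕ → ℂ}
    (h : HasSum (fun n => b n * (c * s ^ 2) ^ n) y) :
    HasSum (fun n => evenCoeff c b n * s ^ n) y := by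
  have hinj : Function.Injective (fun n : ℕ => 2 * n) := fun a b h => by simpa using h
  rw [← hinj.hasSum_iff]
  · convert h using 2 with n
    simp [evenCoeff, mul_pow, pow_mul]
    ring
  · intro n hn
    have : ¬ Even n := fun ⟨m, hm⟩ => hn ⟨m, by simp; omega⟩
    simp [evenCoeff, this]

theorem tendsto_mul_sq (c : ℂ) : Filter.Tendsto (fun s : ℂ => c * s ^ 2) (nhds 0) (nhds 0) := by
  have : Continuous (fun s : ℂ => c * s ^ 2) := by fun_prop
  simpa using this.tendsto 0

theorem taylorCoeff_comp_mul_sq {f : ℂ → ℂ} (hf : AnalyticAt ℂ f 0) (c : ℂ) (n : ℕ) :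
    taylorCoeff n (fun s => f (c * s ^ 2)) = evenCoeff c (fun m => taylorCoeff m f) n := by
  refine taylorCoeff_of_eventually_hasSum ?_ n
  filter_upwards [(tendsto_mul_sq c).eventually (eventually_hasSum_taylorCoeff hf)] with s hs
  exact hasSum_evenCoeff hs

theorem analyticAt_comp_mul_sq {f : ℂ → ℂ} (hf : AnalyticAt ℂ f 0) (c : ℂ) :
    AnalyticAt ℂ (fun s => f (c * s ^ 2)) 0 := by
  have h : AnalyticAt ℂ (fun s : ℂ => c * s ^ 2) 0 := by fun_prop
  exact AnalyticAt.fun_comp (g := f) (by simpa using hf) h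

theorem taylorCoeff_two_mul_comp_mul_sq {f : ℂ → ℂ} (hf : AnalyticAt ℂ f 0) (c : ℂ) (n : ℕ) :
    taylorCoeff (2 * n) (fun s => f (c * s ^ 2)) = c ^ n * taylorCoeff n f := by
  simp [taylorCoeff_comp_mul_sq hf, evenCoeff]

/-! ### Hurwitz series -/

/-- A power series all of whose coefficients times `n!` are integers. -/
def IsHurwitz (f : PowerSeries ℂ) : Prop :=
  ∀ n : ℕ, (n.factorial : ℂ) * PowerSeries.coeff n f ∈ (Int.castRingHom ℂ).range

theorem factorial_mul_coeff_mul (f g : PowerSeries ℂ) (n : ℕ) :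
    (n.factorial : ℂ) * PowerSeries.coeff n (f * g) =
      ∑ p ∈ Finset.HasAntidiagonal.antidiagonal n, (n.choose p.1 : ℂ) *
        ((p.1.factorial * PowerSeries.coeff p.1 f) * (p.2.factorial * PowerSeries.coeff p.2 g)) := by
  rw [PowerSeries.coeff_mul, Finset.mul_sum]
  refine Finset.sum_congr rfl fun p hp => ?_
  rw [Finset.HasAntidiagonal.mem_antidiagonal] at hp
  have : (n.factorial : ℂ) = n.choose p.1 * p.1.factorial * p.2.factorial := by
    have := Nat.choose_mul_factorial_mul_factorial (n := n) (k := p.1) (by omega)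
    rw [show n - p.1 = p.2 by omega] at this
    exact_mod_cast this.symm
  rw [this]
  ring

theorem IsHurwitz.mul {f g : PowerSeries ℂ} (hf : IsHurwitz f) (hg : IsHurwitz g) :
    IsHurwitz (f * g) := fun n => by
  rw [factorial_mul_coeff_mul]
  exact sum_mem fun p _ => mul_mem (natCast_mem _ _) (mul_mem (hf _) (hg _))

theorem factorial_mul_coeff_derivative (f : PowerSeries ℂ) (n : ℕ) :
    (n.factorial : ℂ) * PowerSeries.coeff n (PowerSeries.derivative ℂ f) =
      ((n + 1).factorial : ℂ) * PowerSeries.coeff (n + 1) f := by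
  rw [PowerSeries.coeff_derivative, Nat.factorial_succ]
  push_cast
  ring

theorem IsHurwitz.derivative {f : PowerSeries ℂ} (hf : IsHurwitz f) :
    IsHurwitz (PowerSeries.derivative ℂ f) := fun n => by
  rw [factorial_mul_coeff_derivative]
  exact hf _

theorem IsHurwitz.of_derivative {f : PowerSeries ℂ} (h0 : PowerSeries.constantCoeff f = 0)
    (hf : IsHurwitz (PowerSeries.derivative ℂ f)) : IsHurwitz f := fun n => by
  rcases n with _ | n
  · simp [h0]
  · rw [← factorial_mul_coeff_derivative]
    exact hf _

theorem IsHurwitz.one : IsHurwitz 1 := fun n => by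
  rw [PowerSeries.coeff_one]
  split_ifs with h
  · subst h; simp
  · simp

/-- The derivative of fᵏ⁺¹/(k+1)! is f' · fᵏ/k!, so induction applies; h0 makes the constant of
integration zero. -/
theorem IsHurwitz.pow_div_factorial {f : PowerSeries ℂ} (hf : IsHurwitz f)
    (h0 : PowerSeries.constantCoeff f = 0) (k : ℕ) :
    IsHurwitz (PowerSeries.C ((k.factorial : ℂ)⁻¹) * f ^ k) := by
  induction k with
  | zero => simpa using IsHurwitz.one
  | succ k ih =>
    refine IsHurwitz.of_derivative (by simp [h0]) ?_
    convert hf.derivative.mul ih using 1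
    rw [Derivation.leibniz, Derivation.leibniz_pow]
    have : (PowerSeries.C ((k.factorial : ℂ)⁻¹)) =
        PowerSeries.C (((k + 1).factorial : ℂ)⁻¹) * ((k : PowerSeries ℂ) + 1) := by
      have h1 : ((k : PowerSeries ℂ) + 1) = PowerSeries.C ((k : ℂ) + 1) := by simp
      rw [h1, ← map_mul, Nat.factorial_succ]
      congr 1
      have h2 : (k.factorial : ℂ) ≠ 0 := by exact_mod_cast k.factorial_ne_zero
      have h3 : (k : ℂ) + 1 ≠ 0 := by exact_mod_cast k.succ_ne_zero
      push_cast
      field_simp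
    rw [this, PowerSeries.derivative_C]
    simp
    ring

/-- Since f has constant term 1, the n-th coefficient of g is that of h minus an integral
combination of earlier ones; nothing is divided. -/
theorem IsHurwitz.of_mul_eq {f g h : PowerSeries ℂ} (hf : IsHurwitz f) (hh : IsHurwitz h)
    (h1 : PowerSeries.constantCoeff f = 1) (heq : g * f = h) : IsHurwitz g := fun n => by
  induction n using Nat.strong_induction_on with
  | _ n ih =>
    have key := factorial_mul_coeff_mul g f n
    rw [heq, ← Finset.add_sum_erase (Finset.HasAntidiagonal.antidiagonal n) _
      (show (n, 0) ∈ Finset.HasAntidiagonal.antidiagonal n by simp)] at key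
    simp only [Nat.choose_self, Nat.cast_one, one_mul, Nat.factorial_zero,
      PowerSeries.coeff_zero_eq_constantCoeff, h1, mul_one] at key
    rw [← sub_eq_iff_eq_add] at key
    rw [← key]
    refine sub_mem (hh n) (sum_mem fun p hp => ?_)
    simp only [Finset.mem_erase, Finset.HasAntidiagonal.mem_antidiagonal, ne_eq, Prod.ext_iff] at hp
    exact mul_mem (natCast_mem _ _) (mul_mem (ih _ (by omega)) (hf _))

/-- Differentiating f² = 1 + 2h and cancelling 2 gives f' f = h', a recursion without denominators.
Hence the need for 2h rather than h. -/
theorem IsHurwitz.of_sq_eq {f h : PowerSeries ℂ} (hh : IsHurwitz h)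
    (h1 : PowerSeries.constantCoeff f = 1) (heq : f ^ 2 = 1 + 2 * h) : IsHurwitz f := fun n => by
  induction n using Nat.strong_induction_on with
  | _ n ih =>
    rcases n with _ | n
    · simp [h1]
    have hd : PowerSeries.derivative ℂ f * f = PowerSeries.derivative ℂ h := by
      have h2 := congrArg (PowerSeries.derivative ℂ) heq
      rw [sq, Derivation.leibniz, map_add, Derivation.leibniz] at h2
      have h3 : PowerSeries.derivative ℂ (2 : PowerSeries ℂ) = 0 := by
        exact_mod_cast Derivation.map_natCast (PowerSeries.derivative ℂ) 2
      rw [h3] at h2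
      simp only [smul_eq_mul, Derivation.map_one_eq_zero, mul_zero, add_zero, zero_add] at h2
      have h4 : (2 : PowerSeries ℂ) ≠ 0 := fun h => by
        have := congrArg PowerSeries.constantCoeff h
        rw [map_ofNat, map_zero] at this
        exact two_ne_zero this
      refine mul_left_cancel₀ h4 ?_
      rw [← h2]; ring
    have key := factorial_mul_coeff_mul (PowerSeries.derivative ℂ f) f n
    rw [hd, ← Finset.add_sum_erase (Finset.HasAntidiagonal.antidiagonal n) _
      (show (n, 0) ∈ Finset.HasAntidiagonal.antidiagonal n by simp)] at key
    simp only [Nat.choose_self, Nat.cast_one, one_mul, Nat.factorial_zero,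
      PowerSeries.coeff_zero_eq_constantCoeff, h1, mul_one] at key
    rw [← sub_eq_iff_eq_add, factorial_mul_coeff_derivative, factorial_mul_coeff_derivative] at key
    rw [← key]
    refine sub_mem (hh _) (sum_mem fun p hp => ?_)
    simp only [Finset.mem_erase, Finset.HasAntidiagonal.mem_antidiagonal, ne_eq, Prod.ext_iff] at hp
    rw [factorial_mul_coeff_derivative]
    exact mul_mem (natCast_mem _ _) (mul_mem (ih _ (by omega)) (ih _ (by omega)))

/-! ### The two hypergeometric functions, U and V. -/

theorem hasSum_ordinaryHypergeometric {a b c : ℂ}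
    (habc : ∀ n : ℕ, (n : ℂ) ≠ -a ∧ (n : ℂ) ≠ -b ∧ (n : ℂ) ≠ -c) {z : ℂ} (hz : ‖z‖ < 1) :
    HasSum (fun n => ordinaryHypergeometricCoefficient a b c n * z ^ n)
      (ordinaryHypergeometric a b c z) := by
  have hr := ordinaryHypergeometricSeries_radius_eq_one ℂ a b c habc
  have h := (ordinaryHypergeometricSeries ℂ a b c).hasFPowerSeriesOnBall (by simp [hr])
  have h2 := h.hasSum (y := z) (by
    rw [hr, Metric.mem_eball, edist_zero_right, ← ofReal_norm, ENNReal.ofReal_lt_one]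
    exact hz)
  rw [zero_add] at h2
  simp only [ordinaryHypergeometricSeries_apply_eq, smul_eq_mul] at h2
  exact h2

theorem ordinaryHypergeometricCoefficient_succ (a b c : ℂ) (n : ℕ) :
    ordinaryHypergeometricCoefficient a b c (n + 1) =
      ordinaryHypergeometricCoefficient a b c n * ((a + n) * (b + n) / ((c + n) * (n + 1))) := by
  simp only [ordinaryHypergeometricCoefficient, ascPochhammer_succ_eval, Nat.factorial_succ,
    Nat.cast_mul, mul_inv, Nat.cast_add, Nat.cast_one, div_eq_mul_inv]
  ring

/-- `₂F₁(1/4, 1/4; 1/2; z)`. -/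
noncomputable def hypEven (z : ℂ) : ℂ := ordinaryHypergeometric (1 / 4 : ℂ) (1 / 4 : ℂ) (1 / 2 : ℂ) z

/-- `₂F₁(3/4, 3/4; 3/2; z)`. -/
noncomputable def hypOdd (z : ℂ) : ℂ := ordinaryHypergeometric (3 / 4 : ℂ) (3 / 4 : ℂ) (3 / 2 : ℂ) z

/-- The Taylor coefficients of `hypEven`. -/
noncomputable def hypEvenCoeff (n : ℕ) : ℂ :=
  ordinaryHypergeometricCoefficient (1 / 4 : ℂ) (1 / 4 : ℂ) (1 / 2 : ℂ) n

/-- The Taylor coefficients of `hypOdd`. -/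
noncomputable def hypOddCoeff (n : ℕ) : ℂ :=
  ordinaryHypergeometricCoefficient (3 / 4 : ℂ) (3 / 4 : ℂ) (3 / 2 : ℂ) n

theorem natCast_ne_neg_of_pos {r : ℝ} (hr : 0 < r) (n : ℕ) : (n : ℂ) ≠ -(r : ℂ) := by
  intro h
  have : (n : ℝ) = -r := by exact_mod_cast h
  have := n.cast_nonneg (α := ℝ)
  linarith

theorem hasSum_hypEven {z : ℂ} (hz : ‖z‖ < 1) :
    HasSum (fun n => hypEvenCoeff n * z ^ n) (hypEven z) := by
  refine hasSum_ordinaryHypergeometric (fun n => ?_) hz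
  have h1 := natCast_ne_neg_of_pos (r := 1 / 4) (by norm_num) n
  have h2 := natCast_ne_neg_of_pos (r := 1 / 2) (by norm_num) n
  push_cast at h1 h2
  exact ⟨h1, h1, h2⟩

theorem hasSum_hypOdd {z : ℂ} (hz : ‖z‖ < 1) :
    HasSum (fun n => hypOddCoeff n * z ^ n) (hypOdd z) := by
  refine hasSum_ordinaryHypergeometric (fun n => ?_) hz
  have h1 := natCast_ne_neg_of_pos (r := 3 / 4) (by norm_num) n
  have h2 := natCast_ne_neg_of_pos (r := 3 / 2) (by norm_num) n
  push_cast at h1 h2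
  exact ⟨h1, h1, h2⟩

theorem eventually_norm_lt_one : ∀ᶠ z : ℂ in nhds 0, ‖z‖ < 1 := by
  filter_upwards [Metric.ball_mem_nhds (0 : ℂ) one_pos] with z hz
  simpa using hz

theorem analyticAt_hypEven : AnalyticAt ℂ hypEven 0 :=
  analyticAt_of_eventually_hasSum (eventually_norm_lt_one.mono fun _ h => hasSum_hypEven h)

theorem analyticAt_hypOdd : AnalyticAt ℂ hypOdd 0 :=
  analyticAt_of_eventually_hasSum (eventually_norm_lt_one.mono fun _ h => hasSum_hypOdd h)

theorem taylorCoeff_hypEven (n : ℕ) : taylorCoeff n hypEven = hypEvenCoeff n :=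
  taylorCoeff_of_eventually_hasSum (eventually_norm_lt_one.mono fun _ h => hasSum_hypEven h) n

theorem taylorCoeff_hypOdd (n : ℕ) : taylorCoeff n hypOdd = hypOddCoeff n :=
  taylorCoeff_of_eventually_hasSum (eventually_norm_lt_one.mono fun _ h => hasSum_hypOdd h) n

theorem hypEven_zero : hypEven 0 = 1 := ordinaryHypergeometric_zero _ _ _

theorem hypOdd_zero : hypOdd 0 = 1 := ordinaryHypergeometric_zero _ _ _

theorem hypEvenCoeff_zero : hypEvenCoeff 0 = 1 := by simp [hypEvenCoeff, ordinaryHypergeometricCoefficient]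

theorem hypOddCoeff_zero : hypOddCoeff 0 = 1 := by simp [hypOddCoeff, ordinaryHypergeometricCoefficient]

theorem hypEvenCoeff_succ (n : ℕ) : hypEvenCoeff (n + 1) =
    hypEvenCoeff n * ((1 / 4 + n) ^ 2 / ((1 / 2 + n) * (n + 1))) := by
  rw [hypEvenCoeff, ordinaryHypergeometricCoefficient_succ, sq, hypEvenCoeff]

theorem hypOddCoeff_succ (n : ℕ) : hypOddCoeff (n + 1) =
    hypOddCoeff n * ((3 / 4 + n) ^ 2 / ((3 / 2 + n) * (n + 1))) := by
  rw [hypOddCoeff, ordinaryHypergeometricCoefficient_succ, sq, hypOddCoeff]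

/-- The source of integrality: scaling the argument by 4 clears the denominators of the Pochhammer
symbols, and (2n)! absorbs the rest. -/
theorem factorial_mul_hypEvenCoeff (n : ℕ) : ((2 * n).factorial : ℂ) * (4 ^ n * hypEvenCoeff n) =
    ((∏ j ∈ Finset.range n, (4 * j + 1) ^ 2 : ℕ) : ℂ) := by
  induction n with
  | zero => simp [hypEvenCoeff_zero]
  | succ n ih =>
    rw [Finset.prod_range_succ, Nat.cast_mul, ← ih, hypEvenCoeff_succ,
      show 2 * (n + 1) = 2 * n + 1 + 1 by ring, Nat.factorial_succ, Nat.factorial_succ]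
    have h1 : (1 + 2 * (n : ℂ)) ≠ 0 := by norm_cast; omega
    have h2 : ((n : ℂ) + 1) ≠ 0 := by norm_cast
    push_cast
    field_simp
    ring

theorem factorial_mul_hypOddCoeff (n : ℕ) :
    ((2 * n + 1).factorial : ℂ) * (4 ^ n * hypOddCoeff n) =
      ((∏ j ∈ Finset.range n, (4 * j + 3) ^ 2 : ℕ) : ℂ) := by
  induction n with
  | zero => simp [hypOddCoeff_zero]
  | succ n ih =>
    rw [Finset.prod_range_succ, Nat.cast_mul, ← ih, hypOddCoeff_succ,
      show 2 * (n + 1) + 1 = 2 * n + 1 + 1 + 1 by ring, Nat.factorial_succ,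
      Nat.factorial_succ (2 * n + 1)]
    have h1 : (3 + 2 * (n : ℂ)) ≠ 0 := by norm_cast; omega
    have h2 : ((n : ℂ) + 1) ≠ 0 := by norm_cast
    push_cast
    field_simp
    ring

theorem hypU_eq (t : ℂ) : hypU t = hypOdd (4 * t) / hypEven (4 * t) := rfl

theorem hypV_eq (t : ℂ) : hypV t = hypEven (4 * t) ^ (1 / 2 : ℂ) := rfl

theorem hypU_zero : hypU 0 = 1 := by simp [hypU_eq, hypEven_zero, hypOdd_zero]

theorem hypV_zero : hypV 0 = 1 := by simp [hypV_eq, hypEven_zero]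

theorem analyticAt_comp_four_mul {f : ℂ → ℂ} (hf : AnalyticAt ℂ f 0) :
    AnalyticAt ℂ (fun t => f (4 * t)) 0 :=
  AnalyticAt.fun_comp (g := f) (by simpa using hf) (by fun_prop)

theorem analyticAt_hypU : AnalyticAt ℂ hypU 0 :=
  (analyticAt_comp_four_mul analyticAt_hypOdd).div (analyticAt_comp_four_mul analyticAt_hypEven)
    (by simp)

theorem analyticAt_hypV : AnalyticAt ℂ hypV 0 :=
  (analyticAt_comp_four_mul analyticAt_hypEven).cpow analyticAt_const (by simp [hypEven_zero])

theorem hypV_sq (t : ℂ) : hypV t ^ 2 = hypEven (4 * t) := by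
  rw [hypV_eq, one_div]
  exact_mod_cast Complex.cpow_nat_inv_pow (hypEven (4 * t)) two_ne_zero

/-! ### Integrality of v(n) and r(n,k). -/

theorem vSeq_integral (n : ℕ) : ∃ m : ℤ, vSeq n = m := by
  -- With t = 2s², the number v(n) becomes (2n)! times the coefficient of s²ⁿ, so it suffices that
  -- V(2s²) is a Hurwitz series.
  have hV2 := analyticAt_comp_mul_sq analyticAt_hypV 2
  have hsq : taylorSeries (fun s => hypV (2 * s ^ 2)) ^ 2 =
      taylorSeries (fun s => hypEven (8 * s ^ 2)) := by
    rw [← taylorSeries_pow hV2]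
    congr 1
    ext s
    rw [hypV_sq]
    ring_nf
  let h : PowerSeries ℂ := PowerSeries.mk fun n => if n = 0 then 0 else
    evenCoeff 8 hypEvenCoeff n / 2
  have hh : IsHurwitz h := fun n => by
    rw [PowerSeries.coeff_mk]
    split_ifs with h0
    · simp
    rw [evenCoeff]
    split_ifs with hev
    · obtain ⟨m, rfl⟩ := hev
      have hm : (m + m) / 2 = m := by omega
      obtain ⟨k, rfl⟩ : ∃ k, m = k + 1 := ⟨m - 1, by omega⟩
      have := factorial_mul_hypEvenCoeff (k + 1)
      -- In 8ᵐ = 4ᵐ 2ᵐ the power 4ᵐ goes to the integral product, and one factor of 2ᵐ (m ≥ 1) pays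
      -- for the halving in h.
      rw [hm, ← two_mul, show (8 : ℂ) = 4 * 2 by norm_num, mul_pow, pow_succ (2 : ℂ)]
      rw [show ∀ a b c d : ℂ, a * (b * (c * 2) * d / 2) = c * (a * (b * d)) by intros; ring, this]
      exact mul_mem (pow_mem (ofNat_mem _ 2) _) (natCast_mem _ _)
    · simp
  have hE : taylorSeries (fun s => hypEven (8 * s ^ 2)) = 1 + 2 * h := by
    ext n
    rw [coeff_taylorSeries, taylorCoeff_comp_mul_sq analyticAt_hypEven, map_add,
      show (2 : PowerSeries ℂ) = PowerSeries.C 2 by rw [map_ofNat], PowerSeries.coeff_C_mul,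
      PowerSeries.coeff_mk, PowerSeries.coeff_one, funext taylorCoeff_hypEven]
    split_ifs with h0
    · subst h0
      simp [evenCoeff, hypEvenCoeff_zero]
    · ring
  have hH := hh.of_sq_eq (f := taylorSeries (fun s => hypV (2 * s ^ 2)))
    (by rw [← PowerSeries.coeff_zero_eq_constantCoeff_apply, coeff_taylorSeries, taylorCoeff_zero]
        simp [hypV_zero]) (hsq.trans hE) (2 * n)
  rw [coeff_taylorSeries, taylorCoeff_two_mul_comp_mul_sq analyticAt_hypV] at hH
  obtain ⟨m, hm⟩ := hH
  refine ⟨m, ?_⟩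
  rw [vSeq, mul_comm (2 ^ n : ℂ), mul_assoc, ← hm]
  simp

theorem taylorSeries_hypU_mul (c : ℂ) :
    taylorSeries (fun s => hypU (c * s ^ 2)) * taylorSeries (fun s => hypEven (4 * c * s ^ 2)) =
      taylorSeries (fun s => hypOdd (4 * c * s ^ 2)) := by
  rw [← taylorSeries_mul (analyticAt_comp_mul_sq analyticAt_hypU _)
    (analyticAt_comp_mul_sq analyticAt_hypEven _)]
  refine taylorSeries_congr ?_
  have hne : ∀ᶠ s in nhds (0 : ℂ), hypEven (4 * c * s ^ 2) ≠ 0 :=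
    (analyticAt_comp_mul_sq analyticAt_hypEven (4 * c)).continuousAt.eventually_ne
      (by simp [hypEven_zero])
  filter_upwards [hne] with s hs
  rw [hypU_eq, ← mul_assoc, div_mul_cancel₀ _ hs]

/-- The series W = s U(s²) is a quotient of Hurwitz series with denominator of constant term 1, so
W²ᵏ/(2k)! is Hurwitz. The coefficient of s²ⁿ is already integral before the factor 2ⁿ⁻ᵏ. -/
theorem rArr_integral (n k : ℕ) (hkn : k ≤ n) : ∃ m : ℤ, rArr n k = m := by
  have hU := analyticAt_comp_mul_sq analyticAt_hypU 1
  have heq := taylorSeries_hypU_mul 1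
  set u := taylorSeries (fun s => hypU (1 * s ^ 2)) with hu
  have hE : IsHurwitz (taylorSeries (fun s => hypEven (4 * 1 * s ^ 2))) := fun n => by
    rw [coeff_taylorSeries, taylorCoeff_comp_mul_sq analyticAt_hypEven, evenCoeff,
      taylorCoeff_hypEven]
    split_ifs with hev
    · obtain ⟨m, rfl⟩ := hev
      rw [show (m + m) / 2 = m by omega, ← two_mul, mul_one, factorial_mul_hypEvenCoeff]
      exact natCast_mem _ _
    · simp
  have hO : IsHurwitz (PowerSeries.X * taylorSeries (fun s => hypOdd (4 * 1 * s ^ 2))) := fun n => by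
    rcases n with _ | n
    · simp
    rw [PowerSeries.coeff_succ_X_mul, coeff_taylorSeries, taylorCoeff_comp_mul_sq analyticAt_hypOdd,
      evenCoeff, taylorCoeff_hypOdd]
    split_ifs with hev
    · obtain ⟨m, rfl⟩ := hev
      rw [show (m + m) / 2 = m by omega, ← two_mul, mul_one, factorial_mul_hypOddCoeff]
      exact natCast_mem _ _
    · simp
  have hW : IsHurwitz (PowerSeries.X * u) := by
    refine hE.of_mul_eq hO ?_ (by rw [mul_assoc, heq])
    rw [← PowerSeries.coeff_zero_eq_constantCoeff_apply, coeff_taylorSeries, taylorCoeff_zero]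
    simp [hypEven_zero]
  have hp := hW.pow_div_factorial (by simp) (2 * k) (2 * n)
  have hc : PowerSeries.coeff (2 * n) ((PowerSeries.X * u) ^ (2 * k)) =
      taylorCoeff (n - k) (fun t => hypU t ^ (2 * k)) := by
    rw [mul_pow, show 2 * n = 2 * (n - k) + 2 * k by omega, PowerSeries.coeff_X_pow_mul, hu,
      ← taylorSeries_pow hU, coeff_taylorSeries,
      taylorCoeff_two_mul_comp_mul_sq (f := fun t => hypU t ^ (2 * k)) (analyticAt_hypU.fun_pow _)]
    simp
  rw [PowerSeries.coeff_C_mul, hc] at hp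
  have : rArr n k ∈ (Int.castRingHom ℂ).range := by
    rw [rArr, mul_assoc, div_eq_mul_inv, mul_assoc ((2 * n).factorial : ℂ)]
    exact mul_mem (pow_mem (ofNat_mem _ 2) _) hp
  obtain ⟨m, hm⟩ := this
  exact ⟨m, by rw [← hm]; simp⟩

/-! ### Theta constants on the positive real axis. -/

open HurwitzZeta in
/-- The theta constant `θ₂` on the positive real axis. -/
noncomputable def realTheta2 (x : ℝ) : ℝ := evenKernel ((1 / 2 : ℝ) : UnitAddCircle) x

open HurwitzZeta in
/-- The theta constant `θ₃` on the positive real axis. -/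
noncomputable def realTheta3 (x : ℝ) : ℝ := evenKernel ((0 : ℝ) : UnitAddCircle) x

open HurwitzZeta in
/-- The theta constant `θ₄` on the positive real axis. -/
noncomputable def realTheta4 (x : ℝ) : ℝ := cosKernel ((1 / 2 : ℝ) : UnitAddCircle) x

theorem hasSum_realTheta2 {x : ℝ} (hx : 0 < x) :
    HasSum (fun n : ℤ => Real.exp (-Real.pi * (n + 1 / 2) ^ 2 * x)) (realTheta2 x) :=
  HurwitzZeta.hasSum_int_evenKernel (1 / 2) hx

theorem hasSum_realTheta3 {x : ℝ} (hx : 0 < x) :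
    HasSum (fun n : ℤ => Real.exp (-Real.pi * n ^ 2 * x)) (realTheta3 x) := by
  simpa using! HurwitzZeta.hasSum_int_evenKernel 0 hx

theorem hasSum_realTheta4 {x : ℝ} (hx : 0 < x) :
    HasSum (fun n : ℤ => ((n.negOnePow : ℤ) : ℝ) * Real.exp (-Real.pi * n ^ 2 * x))
      (realTheta4 x) := by
  rw [← Complex.hasSum_ofReal, realTheta4]
  convert HurwitzZeta.hasSum_int_cosKernel (1 / 2) hx using 2 with n
  push_cast
  congr 1
  rw [show (2 * Real.pi * Complex.I * (1 / 2) * n : ℂ) = n * (Real.pi * Complex.I) by ring,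
    Complex.exp_int_mul, Complex.exp_pi_mul_I]
  rcases Int.even_or_odd n with h | h
  · simp [Int.negOnePow_even _ h, h.neg_one_zpow]
  · simp [Int.negOnePow_odd _ h, h.neg_one_zpow]

theorem realTheta2_pos {x : ℝ} (hx : 0 < x) : 0 < realTheta2 x :=
  by
  rw [← (hasSum_realTheta2 hx).tsum_eq]
  exact (hasSum_realTheta2 hx).summable.tsum_pos (fun _ => (Real.exp_pos _).le) 0 (Real.exp_pos _)

theorem realTheta3_pos {x : ℝ} (hx : 0 < x) : 0 < realTheta3 x :=
  by
  rw [← (hasSum_realTheta3 hx).tsum_eq]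
  exact (hasSum_realTheta3 hx).summable.tsum_pos (fun _ => (Real.exp_pos _).le) 0 (Real.exp_pos _)

theorem realTheta2_eq (x : ℝ) : realTheta2 x = 1 / x ^ (1 / 2 : ℝ) * realTheta4 (1 / x) :=
  HurwitzZeta.evenKernel_functional_equation _ x

theorem realTheta3_eq (x : ℝ) : realTheta3 x = 1 / x ^ (1 / 2 : ℝ) * realTheta3 (1 / x) := by
  have := HurwitzZeta.evenKernel_functional_equation 0 x
  rw [← HurwitzZeta.evenKernel_eq_cosKernel_of_zero] at this
  exact this

theorem realTheta4_pos {x : ℝ} (hx : 0 < x) : 0 < realTheta4 x := by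
  have h := realTheta2_pos (x := 1 / x) (by positivity)
  rw [realTheta2_eq, one_div_one_div] at h
  exact pos_of_mul_pos_right h (by positivity)

theorem continuousOn_realTheta3 : ContinuousOn realTheta3 (Set.Ioi 0) :=
  HurwitzZeta.continuousOn_evenKernel _

theorem continuousOn_realTheta4 : ContinuousOn realTheta4 (Set.Ioi 0) :=
  HurwitzZeta.continuousOn_cosKernel _

theorem tendsto_one_of_isBigO_exp {f : ℝ → ℝ} {p : ℝ} (hp : 0 < p)
    (h : (fun x => f x - 1) =O[Filter.atTop] fun x => Real.exp (-p * x)) :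
    Filter.Tendsto f Filter.atTop (nhds 1) := by
  have h1 : Filter.Tendsto (fun x => Real.exp (-p * x)) Filter.atTop (nhds 0) := by
    refine Real.tendsto_exp_atBot.comp ?_
    exact Filter.tendsto_id.const_mul_atTop_of_neg (by linarith)
  simpa using (h.trans_tendsto h1).add_const 1

theorem tendsto_realTheta3 : Filter.Tendsto realTheta3 Filter.atTop (nhds 1) := by
  obtain ⟨p, hp, h⟩ := HurwitzZeta.isBigO_atTop_evenKernel_sub ((0 : ℝ) : UnitAddCircle)
  simp only [QuotientAddGroup.mk_zero, if_true] at h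
  exact tendsto_one_of_isBigO_exp hp h

theorem tendsto_realTheta4 : Filter.Tendsto realTheta4 Filter.atTop (nhds 1) := by
  obtain ⟨p, hp, h⟩ := HurwitzZeta.isBigO_atTop_cosKernel_sub ((1 / 2 : ℝ) : UnitAddCircle)
  exact tendsto_one_of_isBigO_exp hp h

/-! ### Doubling formulas and Jacobi's quartic identity. -/

/-- Splitting of `ℤ × ℤ` according to the parity of the sum of the coordinates. -/
theorem tsum_int_prod_parity {f : ℤ × ℤ → ℝ} (hf : Summable f) :
    ∑' p, f p = ∑' p : ℤ × ℤ, f (p.1 + p.2, p.1 - p.2) +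
      ∑' p : ℤ × ℤ, f (p.1 + p.2 + 1, p.1 - p.2) := by
  let g : (ℤ × ℤ) ⊕ (ℤ × ℤ) → ℤ × ℤ :=
    Sum.elim (fun p => (p.1 + p.2, p.1 - p.2)) (fun p => (p.1 + p.2 + 1, p.1 - p.2))
  have hg : Function.Bijective g := by
    constructor
    · rintro (⟨a, b⟩ | ⟨a, b⟩) (⟨c, d⟩ | ⟨c, d⟩) h <;>
        simp only [g, Sum.elim_inl, Sum.elim_inr, Prod.mk.injEq] at h
      · simp only [Sum.inl.injEq, Prod.mk.injEq]; omega
      · omega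
      · omega
      · simp only [Sum.inr.injEq, Prod.mk.injEq]; omega
    · rintro ⟨m, n⟩
      rcases Int.even_or_odd' (m + n) with ⟨k, hk | hk⟩
      · exact ⟨Sum.inl (k, m - k), by simp only [g, Sum.elim_inl, Prod.mk.injEq]; omega⟩
      · exact ⟨Sum.inr (k, m - 1 - k), by simp only [g, Sum.elim_inr, Prod.mk.injEq]; omega⟩
  have hs : Summable (f ∘ g) := hf.comp_injective hg.injective
  rw [← (Equiv.ofBijective g hg).tsum_eq f]
  exact Summable.tsum_sum (f := f ∘ g) (hs.comp_injective Sum.inl_injective)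
    (hs.comp_injective Sum.inr_injective)

theorem HasSum.mul_tsum_prod {f g : ℤ → ℝ} {a b : ℝ} (hf : HasSum f a) (hg : HasSum g b) :
    (Summable fun p : ℤ × ℤ => f p.1 * g p.2) ∧ ∑' p : ℤ × ℤ, f p.1 * g p.2 = a * b := by
  have h1 : Summable fun n => ‖f n‖ := hf.summable.norm
  have h2 : Summable fun n => ‖g n‖ := hg.summable.norm
  refine ⟨summable_mul_of_summable_norm h1 h2, ?_⟩
  rw [← tsum_mul_tsum_of_summable_norm h1 h2, hf.tsum_eq, hg.tsum_eq]

theorem negOnePow_cast_mul_self (n : ℤ) : (((n.negOnePow : ℤ) : ℝ)) * ((n.negOnePow : ℤ) : ℝ) = 1 := by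
  rcases Int.even_or_odd n with h | h
  · simp [Int.negOnePow_even _ h]
  · simp [Int.negOnePow_odd _ h]

/-- Rotating the lattice: (p+q)² + (p-q)² = 2(p² + q²) on the even class, and (p+q+1)² + (p-q)² =
2((p+½)² + (q+½)²) on the odd one. -/
theorem realTheta3_sq {x : ℝ} (hx : 0 < x) :
    realTheta3 x ^ 2 = realTheta3 (2 * x) ^ 2 + realTheta2 (2 * x) ^ 2 := by
  have h2x : 0 < 2 * x := by positivity
  have h := (hasSum_realTheta3 hx).mul_tsum_prod (hasSum_realTheta3 hx)
  rw [sq, ← h.2, tsum_int_prod_parity h.1, sq, sq,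
    ← ((hasSum_realTheta3 h2x).mul_tsum_prod (hasSum_realTheta3 h2x)).2,
    ← ((hasSum_realTheta2 h2x).mul_tsum_prod (hasSum_realTheta2 h2x)).2]
  congr 1 <;>
  · refine tsum_congr fun p => ?_
    rw [← Real.exp_add, ← Real.exp_add]
    push_cast
    congr 1
    ring

theorem realTheta4_sq {x : ℝ} (hx : 0 < x) :
    realTheta4 x ^ 2 = realTheta3 (2 * x) ^ 2 - realTheta2 (2 * x) ^ 2 := by
  have h2x : 0 < 2 * x := by positivity
  have h := (hasSum_realTheta4 hx).mul_tsum_prod (hasSum_realTheta4 hx)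
  rw [sq, ← h.2, tsum_int_prod_parity h.1, sq, sq,
    ← ((hasSum_realTheta3 h2x).mul_tsum_prod (hasSum_realTheta3 h2x)).2,
    ← ((hasSum_realTheta2 h2x).mul_tsum_prod (hasSum_realTheta2 h2x)).2, sub_eq_add_neg, ← tsum_neg]
  congr 1
  · refine tsum_congr fun p => ?_
    rw [mul_mul_mul_comm, ← Real.exp_add, ← Real.exp_add, Int.negOnePow_add, Int.negOnePow_sub]
    push_cast
    rw [mul_mul_mul_comm, negOnePow_cast_mul_self, negOnePow_cast_mul_self, one_mul, one_mul]
    congr 1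
    ring
  · refine tsum_congr fun p => ?_
    rw [mul_mul_mul_comm, ← Real.exp_add, ← Real.exp_add, Int.negOnePow_succ, Int.negOnePow_add,
      Int.negOnePow_sub]
    push_cast
    rw [neg_mul, mul_mul_mul_comm, negOnePow_cast_mul_self, negOnePow_cast_mul_self, one_mul,
      neg_one_mul]
    congr 2
    ring

theorem realTheta3_mul_realTheta4 {x : ℝ} (hx : 0 < x) :
    realTheta3 x * realTheta4 x = realTheta4 (2 * x) ^ 2 := by
  have h2x : 0 < 2 * x := by positivity
  have h := (hasSum_realTheta3 hx).mul_tsum_prod (hasSum_realTheta4 hx)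
  rw [← h.2, tsum_int_prod_parity h.1, sq,
    ← ((hasSum_realTheta4 h2x).mul_tsum_prod (hasSum_realTheta4 h2x)).2]
  have h0 : ∑' p : ℤ × ℤ, Real.exp (-Real.pi * ((p.1 + p.2 + 1 : ℤ) : ℝ) ^ 2 * x) *
      ((((p.1 - p.2 : ℤ).negOnePow : ℤ) : ℝ) *
        Real.exp (-Real.pi * ((p.1 - p.2 : ℤ) : ℝ) ^ 2 * x)) = 0 := by
    -- This bijection interchanges (p+q+1)² and (p-q)² and reverses the sign, so the odd class
    -- cancels.
    let e : ℤ × ℤ ≃ ℤ × ℤ :=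
      { toFun := fun p => (-1 - p.2, p.1)
        invFun := fun p => (p.2, -1 - p.1)
        left_inv := fun p => by simp
        right_inv := fun p => by simp }
    rw [← self_eq_neg, ← tsum_neg, ← e.tsum_eq]
    refine tsum_congr fun p => ?_
    simp only [e, Equiv.coe_fn_mk]
    rw [show -1 - p.2 - p.1 = (p.1 - p.2 + 1) + 2 * (-1 - p.1) by ring, Int.negOnePow_add,
      Int.negOnePow_two_mul, mul_one, Int.negOnePow_succ]
    push_cast
    ring_nf
  rw [h0, add_zero]
  refine tsum_congr fun p => ?_
  rw [mul_left_comm, mul_mul_mul_comm, ← Real.exp_add, ← Real.exp_add, Int.negOnePow_sub]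
  push_cast
  congr 2
  ring

/-- From the doubling formulas at x/2: θ₄(x)⁴ = θ₃(x/2)² θ₄(x/2)² = (θ₃² + θ₂²)(θ₃² - θ₂²),
evaluated at x. -/
theorem jacobi_quartic {x : ℝ} (hx : 0 < x) :
    realTheta3 x ^ 4 = realTheta2 x ^ 4 + realTheta4 x ^ 4 := by
  have hx2 : 0 < x / 2 := by positivity
  have h1 := realTheta3_sq hx2
  have h2 := realTheta4_sq hx2
  have h3 := realTheta3_mul_realTheta4 hx2
  rw [mul_div_cancel₀ x two_ne_zero] at h1 h2 h3
  have h4 : realTheta4 x ^ 4 = realTheta3 (x / 2) ^ 2 * realTheta4 (x / 2) ^ 2 := by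
    rw [← mul_pow, h3]; ring
  rw [h4, h1, h2]
  ring

/-! ### The elliptic integral and the arithmetic-geometric mean. -/

open MeasureTheory

/-- The complete elliptic integral `∫₀^∞ dt / √((t² + a²) (t² + b²))`. -/
noncomputable def ellipticIntegral (a b : ℝ) : ℝ :=
  ∫ t in Set.Ioi (0 : ℝ), (√((t ^ 2 + a ^ 2) * (t ^ 2 + b ^ 2)))⁻¹

theorem inv_sq_add_sq_eq {a : ℝ} (ha : 0 < a) (t : ℝ) :
    (t ^ 2 + a ^ 2)⁻¹ = (a ^ 2)⁻¹ * (1 + (a⁻¹ * t) ^ 2)⁻¹ := by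
  rw [← mul_inv]
  congr 1
  field_simp
  ring

theorem integrableOn_inv_sq_add_sq {a : ℝ} (ha : 0 < a) :
    IntegrableOn (fun t : ℝ => (t ^ 2 + a ^ 2)⁻¹) (Set.Ioi 0) := by
  simp_rw [inv_sq_add_sq_eq ha]
  refine Integrable.const_mul ?_ _
  have h : IntegrableOn (fun t : ℝ => (1 + t ^ 2)⁻¹) (Set.Ioi (a⁻¹ * 0)) :=
    integrable_inv_one_add_sq.integrableOn
  exact (integrableOn_Ioi_comp_mul_left_iff (fun t : ℝ => (1 + t ^ 2)⁻¹) 0 (inv_pos.2 ha)).2 h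

theorem integral_Ioi_inv_sq_add_sq {a : ℝ} (ha : 0 < a) :
    ∫ t in Set.Ioi (0 : ℝ), (t ^ 2 + a ^ 2)⁻¹ = Real.pi / (2 * a) := by
  simp_rw [inv_sq_add_sq_eq ha]
  rw [integral_const_mul,
    integral_comp_mul_left_Ioi (fun t : ℝ => (1 + t ^ 2)⁻¹) 0 (inv_pos.2 ha), mul_zero,
    integral_Ioi_inv_one_add_sq, Real.arctan_zero, smul_eq_mul]
  field_simp
  ring

theorem inv_sqrt_mul_self {x : ℝ} (hx : 0 < x) : (√(x * x))⁻¹ = x⁻¹ := by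
  rw [Real.sqrt_mul_self hx.le]

theorem inv_sqrt_le_of_le {a b : ℝ} (hb : 0 < b) (hab : b ≤ a) (t : ℝ) :
    (√((t ^ 2 + a ^ 2) * (t ^ 2 + b ^ 2)))⁻¹ ≤ (t ^ 2 + b ^ 2)⁻¹ := by
  have h : 0 < t ^ 2 + b ^ 2 := by positivity
  rw [← inv_sqrt_mul_self h]
  gcongr

theorem le_inv_sqrt_of_le {a b : ℝ} (hb : 0 < b) (hab : b ≤ a) (t : ℝ) :
    (t ^ 2 + a ^ 2)⁻¹ ≤ (√((t ^ 2 + a ^ 2) * (t ^ 2 + b ^ 2)))⁻¹ := by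
  have ha := hb.trans_le hab
  have h : 0 < t ^ 2 + a ^ 2 := by positivity
  rw [← inv_sqrt_mul_self h]
  gcongr

theorem integrableOn_elliptic {a b : ℝ} (hb : 0 < b) (hab : b ≤ a) :
    IntegrableOn (fun t : ℝ => (√((t ^ 2 + a ^ 2) * (t ^ 2 + b ^ 2)))⁻¹) (Set.Ioi 0) := by
  refine (integrableOn_inv_sq_add_sq hb).mono' (Measurable.aestronglyMeasurable (by fun_prop)) ?_
  refine Filter.Eventually.of_forall fun t => ?_
  rw [Real.norm_of_nonneg (by positivity)]
  exact inv_sqrt_le_of_le hb hab t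

theorem ellipticIntegral_le {a b : ℝ} (hb : 0 < b) (hab : b ≤ a) :
    ellipticIntegral a b ≤ Real.pi / (2 * b) := by
  rw [← integral_Ioi_inv_sq_add_sq hb]
  exact setIntegral_mono (integrableOn_elliptic hb hab) (integrableOn_inv_sq_add_sq hb)
    (inv_sqrt_le_of_le hb hab)

theorem le_ellipticIntegral {a b : ℝ} (hb : 0 < b) (hab : b ≤ a) :
    Real.pi / (2 * a) ≤ ellipticIntegral a b := by
  rw [← integral_Ioi_inv_sq_add_sq (hb.trans_le hab)]
  exact setIntegral_mono (integrableOn_inv_sq_add_sq (hb.trans_le hab))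
    (integrableOn_elliptic hb hab) (le_inv_sqrt_of_le hb hab)

theorem image_gauss_transformation {c : ℝ} (hc : 0 < c) :
    (fun t : ℝ => (t - c / t) / 2) '' Set.Ioi 0 = Set.univ := by
  refine Set.eq_univ_of_forall fun u => ?_
  have h1 : 0 ≤ u ^ 2 + c := by positivity
  have h2 : |u| < √(u ^ 2 + c) := by
    rw [← Real.sqrt_sq_eq_abs]
    exact Real.sqrt_lt_sqrt (sq_nonneg u) (by linarith)
  have h3 : 0 < u + √(u ^ 2 + c) := by linarith [neg_abs_le u]
  -- The positive root of t² - 2ut - c = 0.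
  refine ⟨u + √(u ^ 2 + c), h3, ?_⟩
  have h4 := Real.sq_sqrt h1
  simp only
  field_simp
  linear_combination h4

/-- Gauss's invariance of the complete elliptic integral under the arithmetic-geometric mean. -/
theorem ellipticIntegral_agm {a b g : ℝ} (ha : 0 < a) (hb : 0 < b) (hg : g ^ 2 = a * b) :
    ellipticIntegral ((a + b) / 2) g = ellipticIntegral a b := by
  have hc : 0 < a * b := by positivity
  -- The integrand is even, so it is integrated over all of ℝ, which u = (t - ab/t)/2 parametrizes
  -- increasingly by t > 0.
  let h : ℝ → ℝ := fun u => (√((u ^ 2 + ((a + b) / 2) ^ 2) * (u ^ 2 + g ^ 2)))⁻¹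
  have h1 : ∫ u, h u = 2 * ellipticIntegral ((a + b) / 2) g := by
    rw [ellipticIntegral, ← integral_comp_abs]
    simp only [sq_abs, h]
  have h2 : ∫ u, h u = ∫ t in Set.Ioi (0 : ℝ), ((1 + a * b / t ^ 2) / 2) • h ((t - a * b / t) / 2) := by
    rw [← integral_image_eq_integral_deriv_smul_of_monotoneOn measurableSet_Ioi
      (f := fun t : ℝ => (t - a * b / t) / 2), image_gauss_transformation hc, setIntegral_univ]
    · intro t ht
      have ht' : t ≠ 0 := ne_of_gt ht
      refine HasDerivAt.hasDerivWithinAt ?_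
      have := ((hasDerivAt_id t).sub ((hasDerivAt_inv ht').const_mul (a * b))).div_const 2
      convert! this using 1
      field_simp
      ring
    · intro t ht u hu htu
      rw [Set.mem_Ioi] at ht hu
      show (t - a * b / t) / 2 ≤ (u - a * b / u) / 2
      gcongr
  have h3 : ∫ t in Set.Ioi (0 : ℝ), ((1 + a * b / t ^ 2) / 2) • h ((t - a * b / t) / 2) =
      2 * ellipticIntegral a b := by
    rw [ellipticIntegral, ← integral_const_mul]
    refine setIntegral_congr_fun measurableSet_Ioi fun t ht => ?_
    rw [Set.mem_Ioi] at ht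
    simp only [h, smul_eq_mul]
    have e : ((((t - a * b / t) / 2) ^ 2 + ((a + b) / 2) ^ 2) * (((t - a * b / t) / 2) ^ 2 + g ^ 2)) =
        ((t ^ 2 + a ^ 2) * (t ^ 2 + b ^ 2)) * ((1 + a * b / t ^ 2) / 4) ^ 2 := by
      rw [hg]
      field_simp
      ring
    have hp : 0 < (1 + a * b / t ^ 2) / 4 := by positivity
    rw [e, Real.sqrt_mul (by positivity), Real.sqrt_sq hp.le, mul_inv]
    have hq : 0 < √((t ^ 2 + a ^ 2) * (t ^ 2 + b ^ 2)) := by positivity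
    field_simp
    ring
  linarith

theorem realTheta4_le_realTheta3 {x : ℝ} (hx : 0 < x) : realTheta4 x ≤ realTheta3 x := by
  have h := jacobi_quartic hx
  refine le_of_pow_le_pow_left₀ four_ne_zero (realTheta3_pos hx).le ?_
  rw [h]
  exact le_add_of_nonneg_left (by positivity)

theorem ellipticIntegral_theta_two_mul {x : ℝ} (hx : 0 < x) :
    ellipticIntegral (realTheta3 (2 * x) ^ 2) (realTheta4 (2 * x) ^ 2) =
      ellipticIntegral (realTheta3 x ^ 2) (realTheta4 x ^ 2) := by
  have h3 := realTheta3_pos hx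
  have h4 := realTheta4_pos hx
  rw [← ellipticIntegral_agm (a := realTheta3 x ^ 2) (b := realTheta4 x ^ 2)
    (g := realTheta4 (2 * x) ^ 2) (by positivity) (by positivity)
    (by rw [← realTheta3_mul_realTheta4 hx]; ring)]
  congr 1
  linarith [realTheta3_sq hx, realTheta4_sq hx]

/-- Doubling x repeatedly leaves the integral unchanged while θ₃ and θ₄ tend to 1; the bounds
π/(2θ₃²) and π/(2θ₄²) squeeze it. -/
theorem ellipticIntegral_theta {x : ℝ} (hx : 0 < x) :
    ellipticIntegral (realTheta3 x ^ 2) (realTheta4 x ^ 2) = Real.pi / 2 := by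
  have hpos : ∀ n : ℕ, 0 < 2 ^ n * x := fun n => by positivity
  have hconst : ∀ n : ℕ, ellipticIntegral (realTheta3 (2 ^ n * x) ^ 2)
      (realTheta4 (2 ^ n * x) ^ 2) = ellipticIntegral (realTheta3 x ^ 2) (realTheta4 x ^ 2) := by
    intro n
    induction n with
    | zero => simp
    | succ n ih => rw [pow_succ' (2 : ℝ), mul_assoc, ellipticIntegral_theta_two_mul (hpos n), ih]
  have ht : Filter.Tendsto (fun n : ℕ => (2 : ℝ) ^ n * x) Filter.atTop Filter.atTop :=
    (tendsto_pow_atTop_atTop_of_one_lt one_lt_two).atTop_mul_const hx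
  have hlim : ∀ {f : ℝ → ℝ}, Filter.Tendsto f Filter.atTop (nhds 1) →
      Filter.Tendsto (fun n : ℕ => Real.pi / (2 * f (2 ^ n * x) ^ 2)) Filter.atTop
        (nhds (Real.pi / 2)) := by
    intro f hf
    have := (tendsto_const_nhds (x := Real.pi)).div (((hf.comp ht).pow 2).const_mul 2)
      (by norm_num)
    simpa using! this
  have hle : ∀ n : ℕ, realTheta4 (2 ^ n * x) ^ 2 ≤ realTheta3 (2 ^ n * x) ^ 2 := fun n =>
    pow_le_pow_left₀ (realTheta4_pos (hpos n)).le (realTheta4_le_realTheta3 (hpos n)) 2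
  refine le_antisymm ?_ ?_
  · refine ge_of_tendsto' (hlim tendsto_realTheta4) fun n => ?_
    rw [← hconst n]
    exact ellipticIntegral_le (pow_pos (realTheta4_pos (hpos n)) 2) (hle n)
  · refine le_of_tendsto' (hlim tendsto_realTheta3) fun n => ?_
    rw [← hconst n]
    exact le_ellipticIntegral (pow_pos (realTheta4_pos (hpos n)) 2) (hle n)

/-! ### The central integral and its behaviour under inversion. -/

/-- `∫₀¹ w^(-3/4) (1 - w)^(-1/2) (1 + s √w)^(-1/2) dw`. -/
noncomputable def centralIntegral (s : ℝ) : ℝ :=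
  ∫ w in Set.Ioo (0 : ℝ) 1, w ^ (1 / 4 - 1 : ℝ) * (1 - w) ^ (1 / 2 - 1 : ℝ) * (√(1 + s * √w))⁻¹

theorem image_one_add_two_mul_sq {a : ℝ} (ha : 0 < a) :
    (fun t : ℝ => ((1 + 2 * (t / a) ^ 2)⁻¹) ^ 2) '' Set.Ioi 0 = Set.Ioo 0 1 := by
  ext w
  constructor
  · rintro ⟨t, ht, rfl⟩
    rw [Set.mem_Ioi] at ht
    have h : 0 < (t / a) ^ 2 := by positivity
    have h1 : (1 + 2 * (t / a) ^ 2)⁻¹ < 1 := inv_lt_one_of_one_lt₀ (by linarith)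
    exact ⟨by positivity, pow_lt_one₀ (by positivity) h1 two_ne_zero⟩
  · rintro ⟨h0, h1⟩
    have hs : √w < 1 := by rw [Real.sqrt_lt' one_pos]; simpa using h1
    have hs0 : 0 < √w := Real.sqrt_pos.2 h0
    have hp : 0 < (1 / √w - 1) / 2 := by
      have : 1 < 1 / √w := by rw [lt_div_iff₀ hs0]; linarith
      linarith
    refine ⟨a * √((1 / √w - 1) / 2), by rw [Set.mem_Ioi]; positivity, ?_⟩
    simp only
    rw [mul_div_cancel_left₀ _ ha.ne', Real.sq_sqrt hp.le]
    have : 1 + 2 * ((1 / √w - 1) / 2) = 1 / √w := by ring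
    rw [this, one_div, inv_inv, Real.sq_sqrt h0.le]

theorem injOn_one_add_two_mul_sq {a : ℝ} (ha : 0 < a) :
    Set.InjOn (fun t : ℝ => ((1 + 2 * (t / a) ^ 2)⁻¹) ^ 2) (Set.Ioi 0) := by
  intro t ht u hu h
  rw [Set.mem_Ioi] at ht hu
  have h1 := (pow_left_inj₀ (by positivity) (by positivity) two_ne_zero).1 h
  have h2 : (t / a) ^ 2 = (u / a) ^ 2 := by linarith [inv_injective h1]
  have h3 := (pow_left_inj₀ (by positivity) (by positivity) two_ne_zero).1 h2
  field_simp at h3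
  exact h3

/-- Substitute w = v² with v = (1 + 2τ²)⁻¹ and τ = t/a. Then 1 - v² = 4τ²v²(1 + τ²), and 1 + sv =
2v(τ² + (b/a)²) exactly for s = 2(b/a)² - 1. -/
theorem centralIntegral_eq_ellipticIntegral {a b : ℝ} (ha : 0 < a) (hb : 0 < b) :
    centralIntegral (2 * (b / a) ^ 2 - 1) = 2 * √2 * a * ellipticIntegral a b := by
  have hd : ∀ t ∈ Set.Ioi (0 : ℝ), HasDerivWithinAt (fun t : ℝ => ((1 + 2 * (t / a) ^ 2)⁻¹) ^ 2)
      (-(8 * (t / a) * ((1 + 2 * (t / a) ^ 2)⁻¹) ^ 3 / a)) (Set.Ioi 0) t := by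
    intro t ht
    refine HasDerivAt.hasDerivWithinAt ?_
    have h0 : (1 + 2 * (t / a) ^ 2) ≠ 0 := by positivity
    have := ((((((hasDerivAt_id t).div_const a).pow 2).const_mul 2).const_add 1).inv h0).pow 2
    convert! this using 1
    have h1 : a ^ 2 + 2 * t ^ 2 ≠ 0 := by positivity
    change _ = ((2 : ℕ) : ℝ) * (1 + 2 * (t / a) ^ 2)⁻¹ ^ 1 *
      (-(2 * (((2 : ℕ) : ℝ) * (t / a) ^ 1 * (1 / a))) / (1 + 2 * (t / a) ^ 2) ^ 2)
    rw [pow_one, pow_one]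
    field_simp
    ring
  rw [centralIntegral, ← image_one_add_two_mul_sq ha,
    integral_image_eq_integral_abs_deriv_smul measurableSet_Ioi hd (injOn_one_add_two_mul_sq ha),
    ellipticIntegral, ← integral_const_mul]
  refine setIntegral_congr_fun measurableSet_Ioi fun t ht => ?_
  rw [Set.mem_Ioi] at ht
  simp only [smul_eq_mul]
  obtain ⟨τ, hτ, rfl⟩ : ∃ τ, 0 < τ ∧ t = a * τ := ⟨t / a, by positivity, by field_simp⟩
  rw [mul_div_cancel_left₀ _ ha.ne']
  set v := (1 + 2 * τ ^ 2)⁻¹ with hv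
  have hv0 : 0 < v := by positivity
  have hvτ : v * (1 + 2 * τ ^ 2) = 1 := inv_mul_cancel₀ (by positivity)
  have hlt : 1 - v ^ 2 = (2 * τ * v) ^ 2 * (1 + τ ^ 2) := by
    linear_combination (-(1 + v * (1 + 2 * τ ^ 2))) * hvτ
  have e1 : (v ^ 2) ^ (1 / 4 - 1 : ℝ) = (v * √v)⁻¹ := by
    rw [← Real.rpow_natCast, ← Real.rpow_mul hv0.le, Real.sqrt_eq_rpow]
    nth_rewrite 2 [← Real.rpow_one v]
    rw [← Real.rpow_add hv0, ← Real.rpow_neg hv0.le]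
    norm_num
  have e2 : (1 - v ^ 2) ^ (1 / 2 - 1 : ℝ) = (2 * τ * v * √(1 + τ ^ 2))⁻¹ := by
    rw [show (1 / 2 - 1 : ℝ) = -(1 / 2) by norm_num, Real.rpow_neg (by rw [hlt]; positivity),
      ← Real.sqrt_eq_rpow, hlt, Real.sqrt_mul (by positivity), Real.sqrt_sq (by positivity)]
  have e3 : √(1 + (2 * (b / a) ^ 2 - 1) * √(v ^ 2)) = √v * √2 * √(τ ^ 2 + (b / a) ^ 2) := by
    rw [Real.sqrt_sq hv0.le, ← Real.sqrt_mul hv0.le, ← Real.sqrt_mul (by positivity)]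
    congr 1
    linear_combination -hvτ
  have e4 : √(((a * τ) ^ 2 + a ^ 2) * ((a * τ) ^ 2 + b ^ 2)) =
      a ^ 2 * (√(1 + τ ^ 2) * √(τ ^ 2 + (b / a) ^ 2)) := by
    rw [← Real.sqrt_mul (by positivity), ← Real.sqrt_sq (show 0 ≤ a ^ 2 by positivity),
      ← Real.sqrt_mul (by positivity)]
    congr 1
    rw [Real.sqrt_sq (by positivity)]
    field_simp
    ring
  rw [e1, e2, e3, e4, abs_neg, abs_of_pos (by positivity)]
  have h1 : 0 < √(1 + τ ^ 2) := by positivity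
  have h2 : 0 < √(τ ^ 2 + (b / a) ^ 2) := by positivity
  have h3 : √v * √v = v := Real.mul_self_sqrt hv0.le
  have h4 : √2 * √2 = (2 : ℝ) := Real.mul_self_sqrt zero_le_two
  have h5 : 0 < √v := by positivity
  have h6 : 0 < √(2 : ℝ) := by positivity
  generalize √(1 + τ ^ 2) = p at *
  generalize √(τ ^ 2 + (b / a) ^ 2) = q at *
  generalize √v = r at *
  generalize √(2 : ℝ) = c at *
  clear_value v
  subst h3
  field_simp
  linear_combination (-4) * h4

/-- The variable `s = 1 - 2 λ` of the elliptic modular function `λ`, on the imaginary axis. -/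
noncomputable def centralParam (x : ℝ) : ℝ := 2 * (realTheta4 x ^ 2 / realTheta3 x ^ 2) ^ 2 - 1

theorem centralIntegral_centralParam {x : ℝ} (hx : 0 < x) :
    centralIntegral (centralParam x) = √2 * Real.pi * realTheta3 x ^ 2 := by
  rw [centralParam, centralIntegral_eq_ellipticIntegral (pow_pos (realTheta3_pos hx) 2)
    (pow_pos (realTheta4_pos hx) 2), ellipticIntegral_theta hx]
  ring

/-- Inversion exchanges θ₂ and θ₄ up to the factor shared with θ₃; Jacobi's identity then gives the
sign change. -/
theorem centralParam_inv {x : ℝ} (hx : 0 < x) : centralParam (1 / x) = -centralParam x := by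
  have hx' : 0 < 1 / x := by positivity
  have h3 := realTheta3_pos hx
  have h2 := realTheta2_pos hx
  have hr := Real.rpow_pos_of_pos hx (1 / 2)
  have e2 : realTheta4 (1 / x) = x ^ (1 / 2 : ℝ) * realTheta2 x := by
    rw [realTheta2_eq x]; field_simp
  have e3 : realTheta3 (1 / x) = x ^ (1 / 2 : ℝ) * realTheta3 x := by
    rw [realTheta3_eq x]; field_simp
  have hj := jacobi_quartic hx
  rw [centralParam, centralParam, e2, e3]
  field_simp
  linear_combination (-2) * hj

theorem abs_centralParam_lt_one {x : ℝ} (hx : 0 < x) : |centralParam x| < 1 := by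
  have key : ∀ {y : ℝ}, 0 < y → -1 < centralParam y := fun {y} hy => by
    have := realTheta3_pos hy
    have := realTheta4_pos hy
    have : 0 < (realTheta4 y ^ 2 / realTheta3 y ^ 2) ^ 2 := by positivity
    rw [centralParam]
    linarith
  have h := key (y := 1 / x) (by positivity)
  rw [centralParam_inv hx] at h
  exact abs_lt.2 ⟨key hx, by linarith⟩

theorem centralParam_one : centralParam 1 = 0 := by
  have := centralParam_inv one_pos
  rw [div_one] at this
  linarith

theorem realTheta3_inv_sq {x : ℝ} (hx : 0 < x) : realTheta3 (1 / x) ^ 2 = x * realTheta3 x ^ 2 := by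
  have hr := Real.rpow_pos_of_pos hx (1 / 2)
  have h : (x ^ (1 / 2 : ℝ)) ^ 2 = x := by rw [← Real.sqrt_eq_rpow, Real.sq_sqrt hx.le]
  rw [realTheta3_eq x, mul_pow, div_pow, h]
  field_simp

theorem continuousAt_centralParam : ContinuousAt centralParam 1 := by
  have h3 := continuousOn_realTheta3.continuousAt (Ioi_mem_nhds one_pos)
  have h4 := continuousOn_realTheta4.continuousAt (Ioi_mem_nhds one_pos)
  have hne : realTheta3 1 ^ 2 ≠ 0 := (pow_pos (realTheta3_pos one_pos) 2).ne'
  exact ((((h4.pow 2).div (h3.pow 2) hne).pow 2).const_mul 2).sub continuousAt_const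

theorem centralIntegral_neg_centralParam {x : ℝ} (hx : 0 < x) :
    centralIntegral (-centralParam x) = x * centralIntegral (centralParam x) := by
  rw [← centralParam_inv hx, centralIntegral_centralParam (by positivity),
    centralIntegral_centralParam hx, realTheta3_inv_sq hx]
  ring

/-- If s = 0, the functional equation reads K(0) = x K(0) with K(0) > 0. This keeps the points for
the identity theorem away from 0. -/
theorem centralParam_ne_zero {x : ℝ} (hx : 0 < x) (hx1 : x ≠ 1) : centralParam x ≠ 0 := by
  intro h
  have h1 := centralIntegral_neg_centralParam hx
  have h2 := centralIntegral_centralParam hx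
  have h3 : 0 < √2 * Real.pi * realTheta3 x ^ 2 := by
    have := realTheta3_pos hx
    positivity
  rw [← h2] at h3
  rw [h] at h1 h3
  rw [neg_zero] at h1
  exact hx1 (mul_right_cancel₀ h3.ne' (by linarith))

/-! ### Power series of the central integral. -/

theorem Ring.choose_real_succ (a : ℝ) (n : ℕ) :
    Ring.choose a (n + 1) = Ring.choose a n * ((a - n) / (n + 1)) := by
  rw [Ring.choose_eq_smul, Ring.choose_eq_smul, descPochhammer_succ_right, Polynomial.smeval_mul,
    Nat.factorial_succ]
  simp only [Polynomial.smeval_sub, Polynomial.smeval_X, Polynomial.smeval_natCast, smul_eq_mul,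
    pow_one, pow_zero, nsmul_eq_mul, mul_one, Nat.cast_mul, mul_inv]
  push_cast
  ring

theorem hasSum_one_add_rpow (a : ℝ) {x : ℝ} (hx : |x| < 1) :
    HasSum (fun n => Ring.choose a n * x ^ n) ((1 + x) ^ a) := by
  have h := (Real.one_add_rpow_hasFPowerSeriesOnBall_zero (a := a)).hasSum (y := x) (by
    rw [Metric.mem_eball, edist_zero_right, ← ofReal_norm, ENNReal.ofReal_lt_one]
    exact hx)
  simp only [binomialSeries_apply, List.ofFn_const, List.prod_replicate, zero_add,
    smul_eq_mul] at h
  exact h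

theorem integrableOn_beta {α β : ℝ} (hα : 0 < α) (hβ : 0 < β) :
    IntegrableOn (fun w : ℝ => w ^ (α - 1) * (1 - w) ^ (β - 1)) (Set.Ioo 0 1) := by
  have h := Complex.betaIntegral_convergent (u := α) (v := β) (by simpa) (by simpa)
  rw [intervalIntegrable_iff_integrableOn_Ioo_of_le zero_le_one] at h
  refine h.re.congr ?_
  refine ae_restrict_of_forall_mem measurableSet_Ioo fun x hx => ?_
  have : (x : ℂ) ^ ((α : ℂ) - 1) * (1 - (x : ℂ)) ^ ((β : ℂ) - 1) =
      ((x ^ (α - 1) * (1 - x) ^ (β - 1) : ℝ) : ℂ) := by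
    rw [Complex.ofReal_mul, Complex.ofReal_cpow hx.1.le, Complex.ofReal_cpow (by linarith [hx.2])]
    push_cast
    rfl
  simp only [this]
  exact Complex.ofReal_re _

theorem integral_beta {α β : ℝ} (hα : 0 < α) (hβ : 0 < β) :
    ∫ w in Set.Ioo (0 : ℝ) 1, w ^ (α - 1) * (1 - w) ^ (β - 1) = ProbabilityTheory.beta α β := by
  have h := Complex.betaIntegral_eq_Gamma_mul_div α β (by simpa) (by simpa)
  rw [← Complex.ofReal_add, Complex.Gamma_ofReal, Complex.Gamma_ofReal, Complex.Gamma_ofReal] at h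
  have h2 : Complex.betaIntegral α β =
      ((∫ w in Set.Ioo (0 : ℝ) 1, w ^ (α - 1) * (1 - w) ^ (β - 1) : ℝ) : ℂ) := by
    rw [Complex.betaIntegral, intervalIntegral.integral_of_le zero_le_one, integral_Ioc_eq_integral_Ioo,
      ← integral_complex_ofReal]
    refine setIntegral_congr_fun measurableSet_Ioo fun x hx => ?_
    rw [Complex.ofReal_mul, Complex.ofReal_cpow hx.1.le, Complex.ofReal_cpow (by linarith [hx.2])]
    push_cast
    rfl
  rw [h2] at h
  rw [ProbabilityTheory.beta]
  exact_mod_cast h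

theorem beta_add_one {α β : ℝ} (hα : 0 < α) (hβ : 0 < β) :
    ProbabilityTheory.beta (α + 1) β = ProbabilityTheory.beta α β * (α / (α + β)) := by
  rw [ProbabilityTheory.beta, ProbabilityTheory.beta, Real.Gamma_add_one hα.ne',
    show α + 1 + β = α + β + 1 by ring, Real.Gamma_add_one (by positivity)]
  have := Real.Gamma_pos_of_pos (add_pos hα hβ)
  field_simp

/-- The Taylor coefficients of `centralIntegral` at `0`. -/
noncomputable def centralCoeff (n : ℕ) : ℝ :=
  Ring.choose (-(1 / 2) : ℝ) n * ProbabilityTheory.beta (n / 2 + 1 / 4) (1 / 2)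

theorem centralCoeff_zero_pos : 0 < centralCoeff 0 := by
  rw [centralCoeff, Ring.choose_zero_right, one_mul]
  exact ProbabilityTheory.beta_pos (by positivity) (by positivity)

/-- Two steps raise the first beta argument by 1. For n = 2m and n = 2m+1 the ratio is that of the
even and odd hypergeometric series. -/
theorem centralCoeff_add_two (n : ℕ) :
    centralCoeff (n + 2) = centralCoeff n * ((n + 1 / 2) ^ 2 / ((n + 2) * (n + 1))) := by
  rw [centralCoeff, centralCoeff, Ring.choose_real_succ, Ring.choose_real_succ]
  have : ((n + 2 : ℕ) : ℝ) / 2 + 1 / 4 = (n / 2 + 1 / 4) + 1 := by push_cast; ring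
  rw [this, beta_add_one (by positivity) (by positivity)]
  push_cast
  have h1 : (n : ℝ) + 2 ≠ 0 := by positivity
  have h2 : (n : ℝ) / 2 + 1 / 4 + 1 / 2 ≠ 0 := by positivity
  have h3 : (n : ℝ) + 1 + 1 ≠ 0 := by positivity
  have h4 : (3 : ℝ) + n * 2 ≠ 0 := by positivity
  field_simp
  ring

/-- The reflection formula eliminates Γ(3/4). This value is what forces the shape of Φ. -/
theorem centralCoeff_one_div_zero :
    centralCoeff 1 / centralCoeff 0 = -(4 * Real.pi ^ 2 / Real.Gamma (1 / 4) ^ 4) := by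
  have h1 : Real.Gamma (5 / 4) = 1 / 4 * Real.Gamma (1 / 4) := by
    rw [← Real.Gamma_add_one (by norm_num)]; norm_num
  have h2 := Real.Gamma_mul_Gamma_one_sub (1 / 4)
  rw [show Real.pi * (1 / 4) = Real.pi / 4 by ring, Real.sin_pi_div_four,
    show (1 : ℝ) - 1 / 4 = 3 / 4 by norm_num] at h2
  have h3 := Real.Gamma_pos_of_pos (show (0 : ℝ) < 1 / 4 by norm_num)
  have h4 := Real.Gamma_pos_of_pos (show (0 : ℝ) < 3 / 4 by norm_num)
  have h5 := Real.Gamma_pos_of_pos (show (0 : ℝ) < 1 / 2 by norm_num)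
  rw [centralCoeff, centralCoeff, ProbabilityTheory.beta, ProbabilityTheory.beta,
    Ring.choose_one_right, Ring.choose_zero_right]
  norm_num only [Nat.cast_one, Nat.cast_zero]
  rw [h1]
  have h6 : Real.Gamma (3 / 4) ^ 2 = 2 * Real.pi ^ 2 / Real.Gamma (1 / 4) ^ 2 := by
    have h7 : Real.Gamma (3 / 4) = Real.pi / (√2 / 2) / Real.Gamma (1 / 4) := by
      rw [← h2]; field_simp
    rw [h7, div_pow, div_pow, div_pow, Real.sq_sqrt zero_le_two]
    ring
  field_simp at h6 ⊢
  linear_combination (-1) * h6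

/-- Expand (1 + s√w)^(-1/2) binomially; each term is a beta integral. The case n = 0 bounds all of
them on 0 < w < 1, which justifies termwise integration. -/
theorem hasSum_centralIntegral {s : ℝ} (hs : |s| < 1) :
    HasSum (fun n => centralCoeff n * s ^ n) (centralIntegral s) := by
  let F : ℕ → ℝ → ℝ := fun n w => (Ring.choose (-(1 / 2) : ℝ) n * s ^ n) *
    (w ^ ((n / 2 + 1 / 4 : ℝ) - 1) * (1 - w) ^ (1 / 2 - 1 : ℝ))
  have hint : ∀ n, Integrable (F n) (volume.restrict (Set.Ioo 0 1)) := fun n =>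
    (integrableOn_beta (by positivity) (by norm_num)).const_mul _
  have hI0 := integrableOn_beta (α := 1 / 4) (β := 1 / 2) (by norm_num) (by norm_num)
  have hnorm : ∀ n, ∫ w in Set.Ioo 0 1, ‖F n w‖ ≤
      ‖Ring.choose (-(1 / 2) : ℝ) n * s ^ n‖ * ProbabilityTheory.beta (1 / 4) (1 / 2) := by
    intro n
    rw [← integral_beta (by norm_num) (by norm_num), ← integral_const_mul]
    refine setIntegral_mono_on (hint n).norm (hI0.const_mul _) measurableSet_Ioo fun w hw => ?_
    have h0 : 0 ≤ 1 - w := by linarith [hw.2]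
    have h1 := hw.1
    rw [norm_mul, Real.norm_of_nonneg (by positivity : 0 ≤ w ^ ((n / 2 + 1 / 4 : ℝ) - 1) * (1 - w) ^ (1 / 2 - 1 : ℝ))]
    gcongr ?_ * (?_ * ?_)
    exact Real.rpow_le_rpow_of_exponent_ge hw.1 hw.2.le (by
      have : (0 : ℝ) ≤ n / 2 := by positivity
      linarith)
  have hsum : Summable fun n => ∫ w in Set.Ioo 0 1, ‖F n w‖ := by
    refine Summable.of_nonneg_of_le (fun n => integral_nonneg fun w => norm_nonneg _) hnorm ?_
    exact (hasSum_one_add_rpow _ hs).summable.norm.mul_right _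
  have h := hasSum_integral_of_summable_integral_norm hint hsum
  have hterm : ∀ n, ∫ w in Set.Ioo 0 1, F n w = centralCoeff n * s ^ n := fun n => by
    rw [integral_const_mul, integral_beta (by positivity) (by norm_num), centralCoeff]
    ring
  simp only [hterm] at h
  have hval : ∫ w in Set.Ioo 0 1, ∑' n, F n w = centralIntegral s := by
    refine setIntegral_congr_fun measurableSet_Ioo fun w hw => ?_
    have hw0 := hw.1
    have hsw : |s * √w| < 1 := by
      rw [abs_mul, abs_of_nonneg (Real.sqrt_nonneg w)]
      have : √w < 1 := by rw [Real.sqrt_lt' one_pos]; simpa using hw.2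
      nlinarith [abs_nonneg s, Real.sqrt_nonneg w]
    have h1 := (hasSum_one_add_rpow (-(1 / 2)) hsw).mul_left
      (w ^ (1 / 4 - 1 : ℝ) * (1 - w) ^ (1 / 2 - 1 : ℝ))
    have hpos : 0 ≤ 1 + s * √w := by linarith [(abs_lt.1 hsw).1]
    rw [Real.rpow_neg hpos, ← Real.sqrt_eq_rpow] at h1
    change _ = w ^ (1 / 4 - 1 : ℝ) * (1 - w) ^ (1 / 2 - 1 : ℝ) * (√(1 + s * √w))⁻¹
    rw [← h1.tsum_eq]
    refine tsum_congr fun n => ?_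
    simp only [F]
    have : w ^ ((n / 2 + 1 / 4 : ℝ) - 1) = w ^ (1 / 4 - 1 : ℝ) * √w ^ n := by
      rw [Real.sqrt_eq_rpow, ← Real.rpow_natCast, ← Real.rpow_mul hw0.le, ← Real.rpow_add hw0]
      congr 1
      ring
    rw [this]
    ring
  rwa [hval] at h

theorem centralCoeff_two_mul (m : ℕ) : (centralCoeff (2 * m) : ℂ) = centralCoeff 0 * hypEvenCoeff m := by
  induction m with
  | zero => simp [hypEvenCoeff_zero]
  | succ m ih =>
    rw [show 2 * (m + 1) = 2 * m + 2 by ring, centralCoeff_add_two, hypEvenCoeff_succ, ← mul_assoc, ← ih]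
    push_cast
    congr 1
    have h1 : (1 + 2 * (m : ℂ)) ≠ 0 := by norm_cast; omega
    have h2 : ((m : ℂ) + 1) ≠ 0 := by norm_cast
    have h3 : (2 * (m : ℂ) + 1) ≠ 0 := by norm_cast
    have h4 : (2 * (m : ℂ) + 2) ≠ 0 := by norm_cast
    field_simp
    ring

theorem centralCoeff_two_mul_add_one (m : ℕ) :
    (centralCoeff (2 * m + 1) : ℂ) = centralCoeff 1 * hypOddCoeff m := by
  induction m with
  | zero => simp [hypOddCoeff_zero]
  | succ m ih =>
    rw [show 2 * (m + 1) + 1 = 2 * m + 1 + 2 by ring, centralCoeff_add_two, hypOddCoeff_succ,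
      ← mul_assoc, ← ih]
    push_cast
    congr 1
    have h1 : (3 + 2 * (m : ℂ)) ≠ 0 := by norm_cast; omega
    have h2 : ((m : ℂ) + 1) ≠ 0 := by norm_cast
    have h3 : (2 * (m : ℂ) + 1 + 2) ≠ 0 := by norm_cast
    have h4 : (2 * (m : ℂ) + 1 + 1) ≠ 0 := by norm_cast
    field_simp
    ring

theorem ofReal_centralIntegral {s : ℝ} (hs : |s| < 1) :
    (centralIntegral s : ℂ) =
      centralCoeff 0 * hypEven (s ^ 2) + centralCoeff 1 * (s * hypOdd (s ^ 2)) := by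
  have hn : ‖(s : ℂ) ^ 2‖ < 1 := by
    rw [norm_pow, Complex.norm_real, Real.norm_eq_abs]
    exact pow_lt_one₀ (abs_nonneg s) hs two_ne_zero
  have hE : HasSum (fun m => ((centralCoeff (2 * m) * s ^ (2 * m) : ℝ) : ℂ))
      (centralCoeff 0 * hypEven (s ^ 2)) := by
    refine ((hasSum_hypEven hn).mul_left (centralCoeff 0 : ℂ)).congr_fun fun m => ?_
    rw [Complex.ofReal_mul, centralCoeff_two_mul, Complex.ofReal_pow, pow_mul]
    ring
  have hO : HasSum (fun m => ((centralCoeff (2 * m + 1) * s ^ (2 * m + 1) : ℝ) : ℂ))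
      (centralCoeff 1 * (s * hypOdd (s ^ 2))) := by
    rw [← mul_assoc]
    refine ((hasSum_hypOdd hn).mul_left (centralCoeff 1 * s : ℂ)).congr_fun fun m => ?_
    rw [Complex.ofReal_mul, centralCoeff_two_mul_add_one, Complex.ofReal_pow, pow_succ, pow_mul]
    ring
  exact (Complex.hasSum_ofReal.2 (hasSum_centralIntegral hs)).unique
    (HasSum.even_add_odd (f := fun n => ((centralCoeff n * s ^ n : ℝ) : ℂ)) hE hO)

/-! ### Analyticity and parity of σ₃. -/

theorem theta3_ofReal {x : ℝ} (hx : 0 < x) : theta3 x = realTheta3 x := by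
  rw [theta3, ← (Complex.hasSum_ofReal.2 (hasSum_realTheta3 hx)).tsum_eq]
  refine tsum_congr fun n => ?_
  push_cast
  rfl

theorem theta3_eq_jacobiTheta (x : ℂ) : theta3 x = jacobiTheta (Complex.I * x) := by
  rw [theta3, jacobiTheta]
  refine tsum_congr fun n => ?_
  congr 1
  linear_combination (-(Real.pi : ℂ) * (n : ℂ) ^ 2 * x) * Complex.I_sq

theorem analyticAt_theta3_one : AnalyticAt ℂ theta3 1 := by
  have hd : DifferentiableOn ℂ theta3 {x : ℂ | 0 < x.re} := fun x hx => by
    rw [funext theta3_eq_jacobiTheta]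
    have h : DifferentiableAt ℂ jacobiTheta (Complex.I * x) :=
      differentiableAt_jacobiTheta (by simpa using! hx)
    exact (h.comp x (by fun_prop)).differentiableWithinAt
  refine hd.analyticAt (IsOpen.mem_nhds ?_ (by simp))
  exact isOpen_lt continuous_const Complex.continuous_re

theorem analyticAt_sigma3 : AnalyticAt ℂ sigma3 0 := by
  have h1 : AnalyticAt ℂ (fun z : ℂ => 1 + z) 0 := by fun_prop
  have h2 : AnalyticAt ℂ (fun z : ℂ => (1 - z) / (1 + z)) 0 :=
    AnalyticAt.div (by fun_prop) h1 (by simp)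
  have h3 : AnalyticAt ℂ (fun z : ℂ => (1 + z) ^ (1 / 2 : ℂ)) 0 :=
    h1.cpow analyticAt_const (by simp)
  exact (analyticAt_const.div h3 (by simp)).mul
    (AnalyticAt.fun_comp (g := theta3) (by simpa using analyticAt_theta3_one) h2)

theorem sigma3_ofReal {z : ℝ} (h0 : -1 < z) (h1 : z < 1) :
    sigma3 z = ((realTheta3 ((1 - z) / (1 + z)) / √(1 + z) : ℝ) : ℂ) := by
  have hp : 0 < 1 + z := by linarith
  have hx : 0 < (1 - z) / (1 + z) := div_pos (by linarith) hp
  rw [sigma3, Complex.ofReal_div, ← theta3_ofReal hx, Real.sqrt_eq_rpow, Complex.ofReal_cpow hp.le]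
  push_cast
  ring

theorem sigma3_neg_ofReal {z : ℝ} (h0 : -1 < z) (h1 : z < 1) : sigma3 (-z) = sigma3 z := by
  have hp : 0 < 1 + z := by linarith
  have hm : 0 < 1 - z := by linarith
  have hx : 0 < (1 - z) / (1 + z) := div_pos hm hp
  rw [← Complex.ofReal_neg, sigma3_ofReal (by linarith) (by linarith), sigma3_ofReal h0 h1,
    sub_neg_eq_add, ← sub_eq_add_neg, Complex.ofReal_inj]
  have e : (1 + z) / (1 - z) = 1 / ((1 - z) / (1 + z)) := by rw [one_div_div]
  have h3 := realTheta3_pos hx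
  have h3' := realTheta3_pos (one_div_pos.2 hx)
  rw [e, ← pow_left_inj₀ (by positivity) (by positivity) two_ne_zero, div_pow, div_pow,
    Real.sq_sqrt hp.le, Real.sq_sqrt hm.le, realTheta3_inv_sq hx]
  field_simp

theorem tendsto_ofReal_punctured :
    Filter.Tendsto (fun z : ℝ => (z : ℂ)) (nhdsWithin 0 {0}ᶜ) (nhdsWithin 0 {0}ᶜ) := by
  refine tendsto_nhdsWithin_iff.2 ⟨?_, ?_⟩
  · exact (Complex.continuous_ofReal.tendsto' 0 0 (by simp)).mono_left nhdsWithin_le_nhds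
  · filter_upwards [self_mem_nhdsWithin] with z hz
    simpa using hz

/-- On (-1, 1) evenness is the inversion formula for θ₃; the identity theorem carries it to a
complex neighbourhood. -/
theorem sigma3_even : (fun z => sigma3 (-z)) =ᶠ[nhds 0] sigma3 := by
  have hneg : AnalyticAt ℂ (fun z => sigma3 (-z)) 0 :=
    AnalyticAt.fun_comp (g := sigma3) (by simpa using analyticAt_sigma3) (by fun_prop)
  refine (hneg.frequently_eq_iff_eventually_eq analyticAt_sigma3).1 ?_
  refine tendsto_ofReal_punctured.frequently (Filter.Eventually.frequently ?_)
  have : ∀ᶠ z : ℝ in nhds 0, z ∈ Set.Ioo (-1 : ℝ) 1 := Ioo_mem_nhds (by norm_num) one_pos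
  filter_upwards [nhdsWithin_le_nhds this] with z hz
  exact sigma3_neg_ofReal hz.1 hz.2

theorem taylorCoeff_sigma3_odd (k : ℕ) : taylorCoeff (2 * k + 1) sigma3 = 0 := by
  have h := taylorCoeff_congr sigma3_even (2 * k + 1)
  rw [taylorCoeff, iteratedDeriv_comp_neg, neg_zero, Odd.neg_one_pow ⟨k, rfl⟩, neg_one_smul,
    neg_div] at h
  have h2 : -taylorCoeff (2 * k + 1) sigma3 = taylorCoeff (2 * k + 1) sigma3 := h
  exact self_eq_neg.1 h2.symm

/-! ### The hypergeometric parametrization of σ₃. -/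

/-- The ratio of the first two Taylor coefficients of `centralIntegral`. -/
noncomputable def centralRatio : ℝ := centralCoeff 1 / centralCoeff 0

theorem centralRatio_sq_mul_bigPhi : centralRatio ^ 2 * bigPhi = 1 / 8 := by
  have h := Real.Gamma_pos_of_pos (show (0 : ℝ) < 1 / 4 by norm_num)
  have hpi := Real.pi_pos
  rw [centralRatio, centralCoeff_one_div_zero, bigPhi]
  field_simp
  norm_num

theorem centralIntegral_zero : centralIntegral 0 = centralCoeff 0 := by
  have h := ofReal_centralIntegral (s := 0) (by simp)
  simpa [hypEven_zero] using h

theorem centralCoeff_zero_eq : centralCoeff 0 = √2 * Real.pi * realTheta3 1 ^ 2 := by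
  rw [← centralIntegral_zero, ← centralParam_one, centralIntegral_centralParam one_pos]

/-- The parametrization of `σ₃` by hypergeometric functions, on the positive imaginary axis. -/
theorem sigma3_hypergeometric_centralParam {x : ℝ} (hx : 0 < x) :
    sigma3 (centralRatio * (centralParam x * hypU (1 / 4 * (centralParam x : ℂ) ^ 2))) =
      theta3 1 * hypV (1 / 4 * (centralParam x : ℂ) ^ 2) := by
  have hs := abs_centralParam_lt_one hx
  have hK := centralIntegral_centralParam hx
  have hKn := centralIntegral_neg_centralParam hx
  have hp := ofReal_centralIntegral hs
  have hn := ofReal_centralIntegral (s := -centralParam x) (by rwa [abs_neg])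
  have h3 := realTheta3_pos hx
  have h31 := realTheta3_pos one_pos
  have hA := centralCoeff_zero_pos
  have hA1 := centralCoeff_zero_eq
  have hKpos : 0 < centralIntegral (centralParam x) := by rw [hK]; positivity
  generalize centralParam x = s at *
  set K := centralIntegral s
  rw [hKn] at hn
  push_cast at hn
  rw [neg_sq] at hn
  -- Adding the expansions at s and -s isolates the even part, (1 + x)K/2.
  have hE : hypEven ((s : ℂ) ^ 2) = (((1 + x) * K / (2 * centralCoeff 0) : ℝ) : ℂ) := by
    have : (centralCoeff 0 : ℂ) ≠ 0 := by exact_mod_cast hA.ne'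
    push_cast
    field_simp
    linear_combination (-1) * hp - hn
  have hfpos : 0 < (1 + x) * K / (2 * centralCoeff 0) := by positivity
  -- Subtracting them gives the odd part (1 - x)K/2; dividing by the even part yields z.
  have hz : (centralRatio * (s * hypU (1 / 4 * (s : ℂ) ^ 2)) : ℂ) = ((1 - x) / (1 + x) : ℝ) := by
    rw [hypU_eq, ← mul_assoc (4 : ℂ), show (4 * (1 / 4) : ℂ) = 1 by norm_num, one_mul, hE,
      centralRatio]
    have h1 : (centralCoeff 0 : ℂ) ≠ 0 := by exact_mod_cast hA.ne'
    have h2 : (K : ℂ) ≠ 0 := by exact_mod_cast hKpos.ne'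
    have h3 : (1 + x : ℂ) ≠ 0 := by exact_mod_cast (by positivity : (0 : ℝ) < 1 + x).ne'
    push_cast
    field_simp
    linear_combination hn - hp
  have hx1 : 0 < 1 + x := by positivity
  rw [hz, sigma3_ofReal (by rw [lt_div_iff₀ hx1]; linarith) (by rw [div_lt_iff₀ hx1]; linarith),
    show (1 - (1 - x) / (1 + x)) / (1 + (1 - x) / (1 + x)) = x by field_simp; ring,
    show 1 + (1 - x) / (1 + x) = 2 / (1 + x) by field_simp; ring, hypV_eq, ← mul_assoc (4 : ℂ),
    show (4 * (1 / 4) : ℂ) = 1 by norm_num, one_mul, hE, ← Complex.ofReal_one,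
    theta3_ofReal one_pos]
  -- Both sides are now positive reals, so comparing squares suffices.
  have hc : ((1 : ℝ) / 2 : ℂ) = ((1 / 2 : ℝ) : ℂ) := by push_cast; rfl
  rw [hc, ← Complex.ofReal_cpow hfpos.le, ← Real.sqrt_eq_rpow, ← Complex.ofReal_mul,
    Complex.ofReal_inj, ← pow_left_inj₀ (by positivity) (by positivity) two_ne_zero, div_pow, mul_pow,
    Real.sq_sqrt hfpos.le, Real.sq_sqrt (by positivity), hA1, hK]
  have := Real.pi_pos
  field_simp

theorem tendsto_centralParam_punctured :
    Filter.Tendsto (fun x : ℝ => (centralParam x : ℂ)) (nhdsWithin 1 {1}ᶜ) (nhdsWithin 0 {0}ᶜ) := by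
  refine tendsto_ofReal_punctured.comp (tendsto_nhdsWithin_iff.2 ⟨?_, ?_⟩)
  · have h := continuousAt_centralParam.tendsto
    rw [centralParam_one] at h
    exact h.mono_left nhdsWithin_le_nhds
  · filter_upwards [self_mem_nhdsWithin, nhdsWithin_le_nhds (Ioi_mem_nhds one_pos)] with x hx hx0
    exact centralParam_ne_zero hx0 hx

theorem analyticAt_comp_id_mul {f g : ℂ → ℂ} (hf : AnalyticAt ℂ f 0) (hg : AnalyticAt ℂ g 0) :
    AnalyticAt ℂ (fun z => f (z * g z)) 0 :=
  AnalyticAt.fun_comp (g := f) (by simpa using hf) (analyticAt_id.mul hg)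

theorem sigma3_hypergeometric :
    (fun s : ℂ => sigma3 (s * (centralRatio * hypU (1 / 4 * s ^ 2)))) =ᶠ[nhds 0]
      fun s => theta3 1 * hypV (1 / 4 * s ^ 2) := by
  have hl := analyticAt_comp_id_mul analyticAt_sigma3
    ((analyticAt_const (v := (centralRatio : ℂ))).fun_mul (analyticAt_comp_mul_sq analyticAt_hypU (1 / 4)))
  have hr := (analyticAt_const (v := theta3 1)).fun_mul (analyticAt_comp_mul_sq analyticAt_hypV (1 / 4))
  refine (hl.frequently_eq_iff_eventually_eq hr).1 ?_
  refine tendsto_centralParam_punctured.frequently (Filter.Eventually.frequently ?_)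
  filter_upwards [nhdsWithin_le_nhds (Ioi_mem_nhds one_pos)] with x hx
  rw [← sigma3_hypergeometric_centralParam hx]
  congr 1
  ring

/-! ### Coefficient comparison and the recurrence. -/

theorem taylorCoeff_succ_of_eq_add_mul {f R : ℂ → ℂ} (hR : AnalyticAt ℂ R 0)
    (h : ∀ z, f z = f 0 + z * R z) (n : ℕ) : taylorCoeff (n + 1) f = taylorCoeff n R := by
  have h1 : ∀ᶠ z in nhds (0 : ℂ), HasSum
      (fun n => (if n = 0 then f 0 else taylorCoeff (n - 1) R) * z ^ n) (f z) := by
    filter_upwards [eventually_hasSum_taylorCoeff hR] with z hz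
    rw [← hasSum_nat_add_iff' 1]
    simp only [Finset.sum_range_one, pow_zero, mul_one, if_true]
    rw [h z, add_sub_cancel_left]
    refine (hz.mul_left z).congr_fun fun n => ?_
    simp
    ring
  simpa using taylorCoeff_of_eventually_hasSum h1 (n + 1)

/-- The Taylor coefficients of `h(z) f(z g(z))`. -/
theorem taylorCoeff_mul_comp_id_mul {g : ℂ → ℂ} (hg : AnalyticAt ℂ g 0) (n : ℕ) :
    ∀ {f h : ℂ → ℂ}, AnalyticAt ℂ f 0 → AnalyticAt ℂ h 0 →
      taylorCoeff n (fun z => h z * f (z * g z)) = ∑ k ∈ Finset.range (n + 1),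
        taylorCoeff k f * taylorCoeff (n - k) (fun z => h z * g z ^ k) := by
  induction n with
  | zero => intro f h _ _; simp [taylorCoeff_zero, mul_comm]
  | succ n ih =>
    intro f h hf hh
    -- Write f(z) = f(0) + z R(z). The new prefactor h·g is absorbed into h, which is why the
    -- induction runs over all f and h.
    have hR : AnalyticAt ℂ (dslope f 0) 0 := by
      obtain ⟨p, hp⟩ := hf
      exact hp.has_fpower_series_dslope_fslope.analyticAt
    have hfR : ∀ z, f z = f 0 + z * dslope f 0 z := fun z => by
      have := sub_smul_dslope f 0 z
      rw [sub_zero, smul_eq_mul] at this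
      rw [this]; ring
    have hprod := (hh.fun_mul hg).fun_mul (analyticAt_comp_id_mul hR hg)
    have e : taylorSeries (fun z => h z * f (z * g z)) = PowerSeries.C (f 0) * taylorSeries h +
        PowerSeries.X * taylorSeries (fun z => (h z * g z) * dslope f 0 (z * g z)) := by
      rw [← taylorSeries_const, ← taylorSeries_id, ← taylorSeries_mul analyticAt_const hh,
        ← taylorSeries_mul (f := fun z => z) analyticAt_id hprod]
      ext m
      rw [map_add, coeff_taylorSeries, coeff_taylorSeries, coeff_taylorSeries, taylorCoeff, taylorCoeff,
        taylorCoeff, ← add_div, ← iteratedDeriv_add (analyticAt_const.fun_mul hh).contDiffAt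
          (AnalyticAt.fun_mul (f := fun z => z) analyticAt_id hprod).contDiffAt]
      congr 2
      ext z
      rw [hfR (z * g z)]
      simp only [Pi.add_apply]
      ring
    have e2 := congrArg (PowerSeries.coeff (n + 1)) e
    rw [map_add, PowerSeries.coeff_C_mul, PowerSeries.coeff_succ_X_mul, coeff_taylorSeries,
      coeff_taylorSeries, coeff_taylorSeries, ih hR (hh.fun_mul hg)] at e2
    rw [e2, Finset.sum_range_succ' _ (n + 1), add_comm]
    congr 1
    · refine Finset.sum_congr rfl fun k _ => ?_
      rw [taylorCoeff_succ_of_eq_add_mul hR hfR, Nat.add_sub_add_right]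
      congr 2
      ext z
      ring
    · simp [taylorCoeff_zero]

theorem sum_range_two_mul_add_one (f : ℕ → ℂ) (n : ℕ) (hf : ∀ k, f (2 * k + 1) = 0) :
    ∑ k ∈ Finset.range (2 * n + 1), f k = ∑ k ∈ Finset.range (n + 1), f (2 * k) := by
  induction n with
  | zero => simp
  | succ n ih =>
    rw [show 2 * (n + 1) + 1 = 2 * n + 1 + 1 + 1 by ring, Finset.sum_range_succ,
      Finset.sum_range_succ, ih, hf, add_zero, Finset.sum_range_succ _ (n + 1)]
    rfl

theorem taylorCoeff_const_mul {f : ℂ → ℂ} (hf : AnalyticAt ℂ f 0) (c : ℂ) (n : ℕ) :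
    taylorCoeff n (fun z => c * f z) = c * taylorCoeff n f := by
  have h := congrArg (PowerSeries.coeff n) (taylorSeries_mul (analyticAt_const (v := c)) hf)
  rwa [taylorSeries_const, PowerSeries.coeff_C_mul, coeff_taylorSeries, coeff_taylorSeries] at h

theorem taylorCoeff_hypV_eq_sum (n : ℕ) :
    theta3 1 * ((1 / 4) ^ n * taylorCoeff n hypV) = ∑ k ∈ Finset.range (n + 1),
      taylorCoeff (2 * k) sigma3 * ((centralRatio : ℂ) ^ (2 * k) *
        ((1 / 4) ^ (n - k) * taylorCoeff (n - k) (fun t => hypU t ^ (2 * k)))) := by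
  have hU := analyticAt_comp_mul_sq analyticAt_hypU (1 / 4)
  have h := taylorCoeff_congr sigma3_hypergeometric (2 * n)
  rw [taylorCoeff_const_mul (analyticAt_comp_mul_sq analyticAt_hypV (1 / 4)),
    taylorCoeff_two_mul_comp_mul_sq analyticAt_hypV] at h
  rw [← h]
  have h2 := taylorCoeff_mul_comp_id_mul
    ((analyticAt_const (v := (centralRatio : ℂ))).mul hU) (2 * n) (f := sigma3) (h := fun _ => 1)
    analyticAt_sigma3 analyticAt_const
  simp only [one_mul, Pi.mul_apply] at h2
  rw [h2, sum_range_two_mul_add_one _ _ (fun k => by rw [taylorCoeff_sigma3_odd, zero_mul])]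
  refine Finset.sum_congr rfl fun k _ => ?_
  simp only [mul_pow (centralRatio : ℂ)]
  rw [taylorCoeff_const_mul (hU.fun_pow _), ← Nat.mul_sub,
    taylorCoeff_two_mul_comp_mul_sq (f := fun t => hypU t ^ (2 * k)) (analyticAt_hypU.fun_pow _)]

theorem bigPhi_pos : 0 < bigPhi := by
  have := Real.Gamma_pos_of_pos (show (0 : ℝ) < 1 / 4 by norm_num)
  have := Real.pi_pos
  rw [bigPhi]
  positivity

theorem theta3_one_ne_zero : theta3 1 ≠ 0 := by
  rw [← Complex.ofReal_one, theta3_ofReal one_pos]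
  exact_mod_cast (realTheta3_pos one_pos).ne'

/-- The constants match because β²ᵏ = (8Φ)⁻ᵏ: 2ⁿ 4ⁿ · 4⁻⁽ⁿ⁻ᵏ⁾ · 8⁻ᵏ = 2ⁿ⁻ᵏ, and Φ⁻ᵏ is the
normalization of d(k). -/
theorem vSeq_eq_sum (n : ℕ) : vSeq n = ∑ k ∈ Finset.range (n + 1), rArr n k * dSeq k := by
  have hθ := theta3_one_ne_zero
  have hΦ : (bigPhi : ℂ) ≠ 0 := by exact_mod_cast bigPhi_pos.ne'
  have hβ : (centralRatio : ℂ) ^ 2 = 1 / (8 * bigPhi) := by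
    have : (centralRatio : ℂ) ^ 2 * bigPhi = 1 / 8 := by
      rw [← Complex.ofReal_pow, ← Complex.ofReal_mul, centralRatio_sq_mul_bigPhi]
      norm_num
    field_simp
    linear_combination 8 * this
  have h : vSeq n = 2 ^ n * ((2 * n).factorial : ℂ) * 4 ^ n / theta3 1 *
      (theta3 1 * ((1 / 4) ^ n * taylorCoeff n hypV)) := by
    rw [vSeq, one_div, inv_pow]
    field_simp
  rw [h, taylorCoeff_hypV_eq_sum, Finset.mul_sum]
  refine Finset.sum_congr rfl fun k hk => ?_
  have hk' : k ≤ n := Nat.lt_succ_iff.1 (Finset.mem_range.1 hk)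
  obtain ⟨m, rfl⟩ := Nat.exists_eq_add_of_le hk'
  have hf : ((2 * k).factorial : ℂ) ≠ 0 := by exact_mod_cast (2 * k).factorial_ne_zero
  rw [rArr, dSeq, Nat.add_sub_cancel_left, pow_mul, hβ, one_div, one_div, inv_pow, inv_pow, pow_add,
    pow_add, mul_pow, show (8 : ℂ) = 2 * 4 by norm_num, mul_pow]
  field_simp

theorem rArr_zero {n : ℕ} (hn : 1 ≤ n) : rArr n 0 = 0 := by
  have : taylorCoeff n (fun t => hypU t ^ (2 * 0)) = 0 := by
    simp only [mul_zero, pow_zero]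
    rw [← coeff_taylorSeries, taylorSeries_const, PowerSeries.coeff_C, if_neg (by omega)]
  rw [rArr, Nat.sub_zero, this, mul_zero]

theorem rArr_self (n : ℕ) : rArr n n = 1 := by
  have hf : ((2 * n).factorial : ℂ) ≠ 0 := by exact_mod_cast (2 * n).factorial_ne_zero
  simp [rArr, taylorCoeff_zero, hypU_zero, hf]

theorem theorem4 :
    (∀ n : ℕ, ∃ m : ℤ, vSeq n = (m : ℂ)) ∧
    (∀ n k : ℕ, 1 ≤ k → k ≤ n → ∃ m : ℤ, rArr n k = (m : ℂ)) ∧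
    (∀ n : ℕ, 1 ≤ n → dSeq n = vSeq n - ∑ k ∈ Finset.Ico 1 n, rArr n k * dSeq k) := by
  refine ⟨vSeq_integral, fun n k _ hkn => rArr_integral n k hkn, fun n hn => ?_⟩
  -- The top term k = n is d(n) itself, and the term k = 0 vanishes because U⁰ is constant.
  rw [vSeq_eq_sum, Finset.sum_range_succ, rArr_self, Finset.range_eq_Ico,
    Finset.sum_eq_sum_Ico_succ_bot (by omega), rArr_zero hn]
  ring
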